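/- Let $\mathfrak g$ be a finite-dimensional simple complex Lie algebra of simply-laced type, with a Cartan subalgebra, simple roots $\alpha_i$ ($i\in I$), simple reflections $s_i$, positive roots $\Phi_+$ and Cartan matrix $(c_{ij})$. Write $i\sim j$ if $c_{ij}=-1$. Let $Q$ be an orientation of the Dynkin diagram of $\mathfrak g$, and let $\xi:I\to\mathbb Z$ be a height function adapted to $Q$, i.e. $\xi(j)=\xi(i)-1$ whenever there is an arrow $i\to j$ in $Q$. Put $$I^{\le\xi}=\{(i,p)\mid i\in I,\ p\in\xi(i)+2\mathbb Z_{\le 0}\}.$$ For $i\in I$ let $\gamma_i$ be the sum of the $\alpha_j$ over all $j\in I$ such that there is a (possibly trivial) path from $j$ to $i$ in $Q$. Let $\tau_Q=s_{i_1}\cdots s_{i_n}$ be the Coxeter element adapted to $Q$: here $(i_1,\dots,i_n)$ lists every element of $I$ exactly once, $i_1$ is a source of $Q$, and for each $k\ge 2$ the vertex $i_k$ is a source of the quiver obtained from $Q$ by reversing, successively for $l=1,\dots,k-1$, all arrows incident to $i_l$. For $(j,s)\in I^{\le\xi}$ define positive roots $\beta_{j,s}\in\Phi_+$ by $\beta_{j,\xi(j)}=\gamma_j$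 and $\beta_{j,s-2}=\pm\tau_Q(\beta_{j,s})$, with the sign for which this is a positive root. Let $C(z)$ be the quantum Cartan matrix, with entries $C_{ii}(z)=z+z^{-1}$, $C_{ij}(z)=-1$ if $i\sim j$, and $C_{ij}(z)=0$ otherwise. For $m\ge 1$ let $\tilde C_{ij}(m)$ be the coefficient of $z^m$ in the expansion as a power series in $z$ of the $(i,j)$ entry of $C(z)^{-1}$, and put $\tilde C_{ij}(m)=0$ for $m\le 0$. Let $$\widetilde D_\xi:\ \mathbb C[Y_{i,p}^{\pm1},\ (i,p)\in I^{\le\xi}]\longrightarrow\mathbb C(\alpha_i,\ i\in I)$$ be the algebra morphism given by $$\widetilde D_\xi(Y_{i,p})=\prod_{(j,s)\in I^{\le\xi}}\beta_{j,s}^{\ \tilde C_{ij}(s-p-1)-\tilde C_{ij}(s-p+1)}$$ (a product with finitely many factors different from $1$). For a positive root $\beta$ and a nonzero rational fraction $f\in\mathbb C(\alpha_i,\ i\in I)$, let $[\beta;f]\in\mathbb Z$ be the multiplicity of the linear form $\beta$ in $f$ (its multiplicity in the numerator minus its multiplicity in the denominator). Then for every $(i,p)\in I^{\le\xi}$ and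 every $\beta\in\Phi_+$ one has $$\bigl|\,[\beta;\widetilde D_\xi(Y_{i,p})]\,\bigr|\le 1 .$$ -/

import Mathlib

noncomputable section

open scoped Classical

namespace DynkinQuiver

/-! ### Orientations, height functions and adapted sequences -/

section Quiver

variable {V : Type*}

/-- `i` is a source of `Q`: no arrow ends at `i`. -/
def IsSource (Q : Digraph V) (i : V) : Prop :=
  ∀ j, ¬ Q.Adj j i

/-- The quiver `s_i(Q)`: every arrow with source `i` or target `i` is reversed. -/
def reflectAt (Q : Digraph V) (i : V) : Digraph V where
  Adj j k := if j = i ∨ k = i then Q.Adj k j else Q.Adj j k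

/-- The sequence `(i₁, …, i_k)` is adapted to `Q`: `i₁` is a source of `Q`, `i₂` is a source of
`s_{i₁}(Q)`, and so on. -/
def IsAdapted : Digraph V → List V → Prop
  | _, [] => True
  | Q, i :: l => IsSource Q i ∧ IsAdapted (reflectAt Q i) l

/-- A sequence adapted to `Q` in which every vertex occurs exactly once. -/
def IsCoxeterWord (Q : Digraph V) (l : List V) : Prop :=
  l.Nodup ∧ (∀ i, i ∈ l) ∧ IsAdapted Q l

/-- A height function adapted to `Q`: `ξ j = ξ i - 1` for every arrow `i → j`. -/
def IsHeightFunction (Q : Digraph V) (ξ : V → ℤ) : Prop :=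
  ∀ i j, Q.Adj i j → ξ j = ξ i - 1

theorem isAdapted_of_pairwise (ξ : V → ℤ) (l : List V) :
    ∀ Q : Digraph V, l.Nodup → l.Pairwise (fun a b => ξ b ≤ ξ a) →
      (∀ j, ∀ i ∈ l, Q.Adj j i → j ∈ l ∧ ξ i < ξ j) → IsAdapted Q l := by
  induction l with
  | nil => intro Q _ _ _; trivial
  | cons i l ih =>
    intro Q hn hp hQ
    rw [List.nodup_cons] at hn
    rw [List.pairwise_cons] at hp
    refine ⟨?_, ih _ hn.2 hp.2 ?_⟩
    · intro j hj
      obtain ⟨h1, h2⟩ := hQ j i (by simp) hj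
      rcases List.mem_cons.1 h1 with rfl | h1
      · exact lt_irrefl _ h2
      · exact absurd (hp.1 j h1) (not_le.2 h2)
    · intro j k hk hjk
      have hki : k ≠ i := fun h => hn.1 (h ▸ hk)
      by_cases hji : j = i
      · subst hji
        have h : Q.Adj k j := by simpa [reflectAt] using hjk
        exact absurd (hp.1 k hk) (not_le.2 (hQ k j (by simp) h).2)
      · have h : Q.Adj j k := by simpa [reflectAt, hji, hki] using hjk
        obtain ⟨h1, h2⟩ := hQ j k (by simp [hk]) h
        rcases List.mem_cons.1 h1 with h1 | h1
        · exact absurd h1 hji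
        · exact ⟨h1, h2⟩

theorem exists_isCoxeterWord [Fintype V] (Q : Digraph V) (ξ : V → ℤ)
    (hξ : IsHeightFunction Q ξ) : ∃ l, IsCoxeterWord Q l := by
  let le : V → V → Bool := fun a b => decide (ξ b ≤ ξ a)
  let l := (Finset.univ : Finset V).toList.mergeSort le
  have hperm : l.Perm (Finset.univ : Finset V).toList := List.mergeSort_perm _ _
  have hmem : ∀ i, i ∈ l := fun i => hperm.mem_iff.2 (by simp)
  have hnd : l.Nodup := hperm.nodup_iff.2 (Finset.nodup_toList _)
  refine ⟨l, hnd, hmem, isAdapted_of_pairwise ξ l Q hnd ?_ ?_⟩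
  · have h := List.pairwise_mergeSort (le := le)
      (fun a b c h1 h2 => by simp only [le, decide_eq_true_eq] at *; omega)
      (fun a b => by simp only [le, Bool.or_eq_true, decide_eq_true_eq]; omega)
      (Finset.univ : Finset V).toList
    exact h.imp (fun h => by simpa [le] using h)
  · intro j i _ hji
    refine ⟨hmem j, ?_⟩
    have := hξ j i hji
    omega

/-- A chosen sequence adapted to `Q` in which every vertex occurs exactly once. -/
def coxeterWord (Q : Digraph V) : List V :=
  Classical.epsilon (IsCoxeterWord Q)

theorem coxeterWord_spec [Fintype V] (Q : Digraph V) (ξ : V → ℤ)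
    (hξ : IsHeightFunction Q ξ) : IsCoxeterWord Q (coxeterWord Q) :=
  Classical.epsilon_spec (exists_isCoxeterWord Q ξ hξ)

/-- The set `I^{≤ξ}` of the pairs `(i, p)` with `p ∈ ξ(i) + 2ℤ_{≤0}`. -/
abbrev Below (ξ : V → ℤ) : Type _ :=
  {x : V × ℤ // ∃ k : ℕ, x.2 = ξ x.1 - 2 * (k : ℤ)}

end Quiver

/-! ### The inverse of the quantum Cartan matrix -/

section QuantumCartan

variable {V : Type*} [Fintype V]

/-- The quantum Cartan matrix `C(z)` of a simply-laced Cartan matrix `C`, with entries in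
`ℤ((z))`: `z + z⁻¹` on the diagonal, `-1` where `c_{ij} = -1`, and `0` elsewhere. -/
def quantumCartan (C : Matrix V V ℤ) : Matrix V V (LaurentSeries ℤ) :=
  Matrix.of fun i j =>
    if i = j then HahnSeries.single 1 1 + HahnSeries.single (-1) 1
    else if C i j = -1 then -1 else 0

/-- The coefficient `C̃_{ij}(m)` of `z ^ m` in the power series expansion of the `(i, j)` entry of
`C(z)⁻¹` for `m ≥ 1`, extended by `0` to `m ≤ 0`. -/
def cTilde (C : Matrix V V ℤ) (i j : V) (m : ℤ) : ℤ :=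
  if 1 ≤ m then ((quantumCartan C)⁻¹ i j).coeff m else 0

theorem isUnit_det_quantumCartan (C : Matrix V V ℤ) : IsUnit (quantumCartan C).det := by
  let B : Matrix V V (PowerSeries ℤ) := Matrix.of fun i j =>
    if i = j then 1 + PowerSeries.X ^ 2 else if C i j = -1 then -PowerSeries.X else 0
  have hB : IsUnit B.det := by
    rw [PowerSeries.isUnit_iff_constantCoeff, RingHom.map_det]
    have : (PowerSeries.constantCoeff (R := ℤ)).mapMatrix B = 1 := by
      ext i j
      by_cases h : i = j
      · subst h
        simp [B]
      · by_cases h' : C i j = -1 <;> simp [B, h, h']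
    rw [this]
    simp
  have hz : IsUnit (HahnSeries.single (-1 : ℤ) (1 : ℤ)) :=
    IsUnit.of_mul_eq_one (HahnSeries.single (1 : ℤ) (1 : ℤ)) (by simp)
  have h : quantumCartan C =
      (HahnSeries.single (-1 : ℤ) (1 : ℤ)) • (HahnSeries.ofPowerSeries ℤ ℤ).mapMatrix B := by
    ext1 i j
    by_cases h : i = j
    · simp [quantumCartan, B, h, mul_add, HahnSeries.ofPowerSeries_X_pow, add_comm]
    · by_cases h' : C i j = -1 <;>
        simp [quantumCartan, B, h, h', HahnSeries.ofPowerSeries_X]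
  rw [h, Matrix.det_smul, ← RingHom.map_det]
  exact (hz.pow _).mul (hB.map _)

end QuantumCartan

/-! ### The roots `β_{j,s}` and the morphism `D̃_ξ` -/

section RootSystem

variable {ι M N : Type*} [AddCommGroup M] [Module ℂ M] [AddCommGroup N] [Module ℂ N]
  {P : RootPairing ι ℂ M N} (b : P.Base)

/-- `Q` is an orientation of the Dynkin diagram: the underlying graph of `Q` has an edge between
`i` and `j` exactly when `c_{ij} = -1`, and every edge carries exactly one direction. -/
structure IsOrientation [P.IsCrystallographic] (Q : Digraph b.support) : Prop where
  adj_or_adj_iff : ∀ i j, (Q.Adj i j ∨ Q.Adj j i) ↔ b.cartanMatrix i j = -1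
  asymm : ∀ i j, Q.Adj i j → ¬ Q.Adj j i

/-- The Coxeter element `τ_Q = s_{i₁} ⋯ s_{i_n}`, where `(i₁, …, i_n)` is a sequence adapted to
`Q` in which every vertex occurs exactly once. -/
def coxeterElement (Q : Digraph b.support) : M ≃ₗ[ℂ] M :=
  ((coxeterWord Q).map fun i => P.reflection i).prod

/-- `γ_i`, the sum of the simple roots `α_j` over all `j` such that `Q` has a path from `j` to `i`
(the path of length zero included). -/
def gammaRoot (Q : Digraph b.support) (i : b.support) : M :=
  ∑ j ∈ Finset.univ.filter (fun j : b.support => Relation.ReflTransGen Q.Adj j i), P.root j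

/-- The vector `v` is a positive root. -/
def IsPosRoot (v : M) : Prop :=
  ∃ k, b.IsPos k ∧ P.root k = v

/-- `betaSeq b Q j m` is `β_{j, ξ(j) - 2m}`, given by `β_{j, ξ(j)} = γ_j` and
`β_{j, s-2} = ± τ_Q (β_{j,s})`, with the sign that makes it a positive root. -/
def betaSeq (Q : Digraph b.support) (j : b.support) : ℕ → M
  | 0 => gammaRoot b Q j
  | m + 1 =>
    if IsPosRoot b (coxeterElement b Q (betaSeq Q j m)) then coxeterElement b Q (betaSeq Q j m)
    else -coxeterElement b Q (betaSeq Q j m)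

/-- The positive root `β_{j,s}` for `(j, s) ∈ I^{≤ξ}`. -/
def beta (Q : Digraph b.support) {ξ : b.support → ℤ} (x : Below ξ) : M :=
  betaSeq b Q x.1.1 ((ξ x.1.1 - x.1.2) / 2).toNat

variable [P.IsRootSystem]

/-- The polynomial ring `ℂ[α_i, i ∈ I]`. -/
abbrev RootPoly : Type _ := MvPolynomial b.support ℂ

/-- The field `ℂ(α_i, i ∈ I)`. -/
abbrev RootField : Type _ := FractionRing (RootPoly b)

/-- A vector `∑ c_i α_i` regarded as the linear form `∑ c_i α_i` in `ℂ[α_i, i ∈ I]`. -/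
def linForm (v : M) : RootPoly b :=
  ∑ i, MvPolynomial.C (b.toWeightBasis.repr v i) * MvPolynomial.X i

/-- The multiplicity `[β; f]` of `β` in the rational fraction `f ≠ 0`: the multiplicity of the
linear form `β` in the numerator of `f` minus its multiplicity in the denominator. -/
def rootMult (v : M) (f : RootField b) : ℤ :=
  (multiplicity (linForm b v) (IsFractionRing.num (RootPoly b) f) : ℤ) -
    (multiplicity (linForm b v) (IsFractionRing.den (RootPoly b) f : RootPoly b) : ℤ)

theorem linForm_ne_zero {v : M} (hv : v ≠ 0) : linForm b v ≠ 0 := by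
  intro h
  apply hv
  apply b.toWeightBasis.repr.injective
  ext i
  have h' := congrArg (MvPolynomial.coeff (Finsupp.single i 1)) h
  simpa [linForm, MvPolynomial.coeff_sum, MvPolynomial.coeff_C_mul, MvPolynomial.coeff_X,
    Finsupp.single_left_inj] using h'

theorem gammaRoot_ne_zero (Q : Digraph b.support) (i : b.support) : gammaRoot b Q i ≠ 0 := by
  intro h
  have h' := congrArg (fun v => b.toWeightBasis.repr v i) h
  simp [gammaRoot, Finsupp.single_apply, Finset.sum_ite_eq', Relation.ReflTransGen.refl] at h'

theorem beta_ne_zero (Q : Digraph b.support) {ξ : b.support → ℤ} (x : Below ξ) :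
    beta b Q x ≠ 0 := by
  have key : ∀ j m, betaSeq b Q j m ≠ 0 := by
    intro j m
    induction m with
    | zero => exact gammaRoot_ne_zero b Q j
    | succ m ih =>
      rw [betaSeq]
      split_ifs
      · simpa using ih
      · simpa using ih
  exact key _ _

/-- The element `β_{j,s}` of the multiplicative group of `ℂ(α_i, i ∈ I)`. -/
def betaUnit (Q : Digraph b.support) {ξ : b.support → ℤ} (x : Below ξ) : (RootField b)ˣ :=
  Units.mk0 (algebraMap (RootPoly b) (RootField b) (linForm b (beta b Q x))) (by
    rw [Ne, map_eq_zero_iff _ (IsFractionRing.injective (RootPoly b) (RootField b))]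
    exact linForm_ne_zero b (beta_ne_zero b Q x))

variable [P.IsCrystallographic]

/-- The product of the `β_{j,s} ^ (C̃_{ij}(s - p - 1) - C̃_{ij}(s - p + 1))` over all
`(j, s) ∈ I^{≤ξ}`, for `x = (i, p)`; almost all of its factors are `1`. -/
def dTildeValue (Q : Digraph b.support) (ξ : b.support → ℤ) (x : Below ξ) : (RootField b)ˣ :=
  ∏ᶠ y : Below ξ, betaUnit b Q y ^
    (cTilde b.cartanMatrix x.1.1 y.1.1 (y.1.2 - x.1.2 - 1) -
      cTilde b.cartanMatrix x.1.1 y.1.1 (y.1.2 - x.1.2 + 1))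

theorem finite_mulSupport_dTildeValue (Q : Digraph b.support) (ξ : b.support → ℤ)
    (x : Below ξ) :
    (Function.mulSupport fun y : Below ξ => betaUnit b Q y ^
      (cTilde b.cartanMatrix x.1.1 y.1.1 (y.1.2 - x.1.2 - 1) -
        cTilde b.cartanMatrix x.1.1 y.1.1 (y.1.2 - x.1.2 + 1))).Finite := by
  have hfin : (⋃ j : b.support, (fun s : ℤ => (j, s)) '' Set.Icc x.1.2 (ξ j)).Finite :=
    Set.finite_iUnion fun j => (Set.finite_Icc _ _).image _
  refine (hfin.preimage (f := Subtype.val) Subtype.val_injective.injOn).subset ?_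
  rintro ⟨⟨j, s⟩, k, hk⟩ hy
  simp only at hk
  simp only [Set.mem_preimage, Set.mem_iUnion]
  refine ⟨j, s, ⟨?_, by omega⟩, rfl⟩
  by_contra hlt
  apply hy
  have h1 : ¬ (1 ≤ s - x.1.2 - 1) := by omega
  have h2 : ¬ (1 ≤ s - x.1.2 + 1) := by omega
  simp [cTilde, h1, h2]

/-- The complexified torus `ℂ ⊗ 𝒴^{≤ξ} = ℂ[Y_{i,p}^{±1}, (i,p) ∈ I^{≤ξ}]`, the group algebra of
the free abelian group on `I^{≤ξ}`. -/
abbrev YTorus {V : Type*} (ξ : V → ℤ) : Type _ := AddMonoidAlgebra ℂ (Below ξ →₀ ℤ)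

/-- The variable `Y_{i,p}`. -/
def yVar {V : Type*} {ξ : V → ℤ} (x : Below ξ) : YTorus ξ :=
  AddMonoidAlgebra.single (Finsupp.single x 1) 1

/-- The algebra morphism `D̃_ξ : ℂ ⊗ 𝒴^{≤ξ} → ℂ(α_i, i ∈ I)`. -/
def dTilde (Q : Digraph b.support) (ξ : b.support → ℤ) : YTorus ξ →ₐ[ℂ] RootField b :=
  AddMonoidAlgebra.lift ℂ (RootField b) (Below ξ →₀ ℤ)
    ((Units.coeHom (RootField b)).comp
      (AddMonoidHom.toMultiplicativeLeft (Finsupp.liftAddHom fun x : Below ξ =>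
        (zmultiplesHom (Additive (RootField b)ˣ) (Additive.ofMul (dTildeValue b Q ξ x))))))

theorem dTilde_yVar (Q : Digraph b.support) (ξ : b.support → ℤ) (x : Below ξ) :
    dTilde b Q ξ (yVar x) = (dTildeValue b Q ξ x : RootField b) := by
  simp [dTilde, yVar]

end RootSystem

end DynkinQuiver

end

/-! Work in the root lattice with its even positive definite form. Let `v_{j,s} = τ^m γ_j`, where `s
= ξ(j) - 2m`; then `v_{j,s} = ±β_{j,s}`, and the sign is irrelevant for multiplicities because
proportional linear forms are associated primes. The multiplicity of `β` in the image of `Y_{i,p}`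
is therefore the sum of the exponents over the places `(j,s)` with `v_{j,s} = ±β`.

Two facts evaluate this sum. First, the `v_{j,s}` satisfy the mesh relation `v_{k,s} + v_{k,s-2} =
∑_{j ∼ k} v_{j,s-1}`, and `C(z)⁻¹ C(z) = 1` gives the same recursion for the coefficients of
`C(z)⁻¹`. Hence for `s > p` the exponent at `(j,s)` equals `-(v_{i,p}, v_{j,s})` (`form_rootAt_eq`),
while at level `s = p` only `(i,p)` contributes, with exponent `-1`.

Second, let `w` be the product of the simple reflections at all places with `s > p`, taken in order
of decreasing `s`. Then `w α_i = v_{i,p}`. As the reflections are inserted one level at a time,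
`w⁻¹β` changes sign exactly when it meets `±α_j`, that is, when `v_{j,s} = ±β`. So the signed count
of these places telescopes to the indicator `ε ∈ {0,1}` of `w⁻¹β < 0` (`exists_truncated`).

The multiplicity is thus `-(v_{i,p}, β) ε`, minus `1` if `v_{i,p} = ±β`. If `v_{i,p} ≠ ±β`, the
pairing lies in `{-1,0,1}`. If `v_{i,p} = β`, then `w⁻¹β = α_i`, so `ε = 0` and the value is `-1`.
If `v_{i,p} = -β`, then `ε = 1` and the value is `2 - 1 = 1`. -/

namespace DynkinQuiver

open scoped Classical

/-! ### The root lattice: norm 2 vectors, simple reflections and sign changes -/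

section Lattice

variable {V : Type*}

/-- The basis vector of the root lattice `V → ℤ` that stands for a simple root. -/
noncomputable def simple (i : V) : V → ℤ := Pi.single i 1

theorem simple_apply (i j : V) : simple i j = if j = i then 1 else 0 := by
  simp [simple, Pi.single_apply]

theorem not_simple_nonpos (i : V) : ¬ simple i ≤ (0 : V → ℤ) := by
  intro h
  have := h i
  simp [simple_apply] at this

variable [Fintype V]

/-- The bilinear form of the root lattice with Gram matrix `C`. -/
noncomputable def latticeForm (C : Matrix V V ℤ) : LinearMap.BilinForm ℤ (V → ℤ) :=
  Matrix.toBilin' C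

theorem latticeForm_apply (C : Matrix V V ℤ) (x y : V → ℤ) :
    latticeForm C x y = ∑ i, ∑ j, x i * C i j * y j :=
  Matrix.toBilin'_apply C x y

/-- A positive definite, simply-laced, symmetric Cartan matrix. -/
structure IsPosSimplyLaced (C : Matrix V V ℤ) : Prop where
  diag : ∀ i, C i i = 2
  symm : ∀ i j, C i j = C j i
  off : ∀ i j, i ≠ j → C i j = 0 ∨ C i j = -1
  pos : ∀ x : V → ℤ, x ≠ 0 → 0 < latticeForm C x x

/-- The indicator, with values in `ℤ`, of non-positive lattice vectors. -/
noncomputable def negInd (v : V → ℤ) : ℤ := if v ≤ 0 then 1 else 0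

variable {C : Matrix V V ℤ}

theorem form_simple (C : Matrix V V ℤ) (i j : V) :
    latticeForm C (simple i) (simple j) = C i j :=
  Matrix.toBilin'_single C i j

theorem eq_sum_simple (x : V → ℤ) : x = ∑ i, x i • simple i := by
  ext j
  simp [simple_apply]

namespace IsPosSimplyLaced

theorem form_comm (hC : IsPosSimplyLaced C) (x y : V → ℤ) :
    latticeForm C x y = latticeForm C y x := by
  simp only [latticeForm_apply]
  rw [Finset.sum_comm]
  refine Finset.sum_congr rfl fun i _ => Finset.sum_congr rfl fun j _ => ?_
  rw [hC.symm]
  ring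

theorem even_form_self (hC : IsPosSimplyLaced C) (x : V → ℤ) :
    Even (latticeForm C x x) := by
  rw [eq_sum_simple x]
  induction (Finset.univ : Finset V) using Finset.induction_on with
  | empty => simp
  | insert i s hi ih =>
    rw [Finset.sum_insert hi]
    simp only [map_add, LinearMap.add_apply]
    rw [hC.form_comm (∑ j ∈ s, x j • simple j) (x i • simple i)]
    have h : latticeForm C (x i • simple i) (x i • simple i) = 2 * (x i * x i) := by
      simp only [map_smul, LinearMap.smul_apply, form_simple, hC.diag, smul_eq_mul]
      ring
    rw [h]
    obtain ⟨k, hk⟩ := ih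
    rw [hk]
    exact ⟨x i * x i + latticeForm C (x i • simple i) (∑ j ∈ s, x j • simple j) + k, by ring⟩

/-- If both `v⁺` and `v⁻` were nonzero, each would have norm at least 2 by evenness. Their supports
are disjoint and the off-diagonal entries are nonpositive, so `(v⁺, v⁻) ≤ 0` and `v` would have norm
at least 4. -/
theorem nonneg_or_nonpos (hC : IsPosSimplyLaced C) {v : V → ℤ}
    (hv : latticeForm C v v = 2) : 0 ≤ v ∨ v ≤ 0 := by
  by_contra hcon
  push Not at hcon
  have hp : v⁺ ≠ 0 := fun h => hcon.2 (posPart_eq_zero.1 h)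
  have hn : v⁻ ≠ 0 := fun h => hcon.1 (negPart_eq_zero.1 h)
  have h1 := hC.pos _ hp
  have h2 := hC.pos _ hn
  obtain ⟨k1, hk1⟩ := hC.even_form_self v⁺
  obtain ⟨k2, hk2⟩ := hC.even_form_self v⁻
  have h3 : latticeForm C v⁺ v⁻ ≤ 0 := by
    rw [latticeForm_apply]
    refine Finset.sum_nonpos fun i _ => Finset.sum_nonpos fun j _ => ?_
    have hi : 0 ≤ v⁺ i := posPart_nonneg v i
    have hj : 0 ≤ v⁻ j := negPart_nonneg v j
    by_cases hij : i = j
    · subst hij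
      have : v⁺ i = 0 ∨ v⁻ i = 0 := by
        rw [Pi.posPart_apply, Pi.negPart_apply]
        rcases le_total (v i) 0 with h | h
        · left; exact posPart_eq_zero.2 h
        · right; exact negPart_eq_zero.2 h
      rcases this with h | h <;> simp [h]
    · rcases hC.off i j hij with h | h <;> rw [h]
      · simp
      · nlinarith
  have h4 : latticeForm C v v = latticeForm C v⁺ v⁺ + latticeForm C v⁻ v⁻
      - 2 * latticeForm C v⁺ v⁻ := by
    conv_lhs => rw [← posPart_sub_negPart v]
    simp only [map_sub, LinearMap.sub_apply]
    rw [hC.form_comm v⁻ v⁺]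
    ring
  omega

theorem form_le_one (hC : IsPosSimplyLaced C) {v w : V → ℤ} (hv : latticeForm C v v = 2)
    (hw : latticeForm C w w = 2) (h : v ≠ w) : latticeForm C v w ≤ 1 := by
  have := hC.pos (v - w) (sub_ne_zero.2 h)
  simp only [map_sub, LinearMap.sub_apply] at this
  rw [hC.form_comm w v] at this
  omega

theorem neg_one_le_form (hC : IsPosSimplyLaced C) {v w : V → ℤ}
    (hv : latticeForm C v v = 2) (hw : latticeForm C w w = 2) (h : v ≠ -w) :
    -1 ≤ latticeForm C v w := by
  have := hC.form_le_one hv (w := -w) (by simpa using hw) h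
  simp only [map_neg] at this
  omega

theorem form_simple_self (hC : IsPosSimplyLaced C) (i : V) :
    (latticeForm C).flip (simple i) (simple i) = 2 := by
  simp [form_simple, hC.diag]

/-- The simple reflection `v ↦ v - (v, α_i) α_i` of the root lattice. -/
noncomputable def refl (hC : IsPosSimplyLaced C) (i : V) : (V → ℤ) ≃ₗ[ℤ] (V → ℤ) :=
  Module.reflection (hC.form_simple_self i)

theorem refl_apply (hC : IsPosSimplyLaced C) (i : V) (v : V → ℤ) :
    hC.refl i v = v - latticeForm C v (simple i) • simple i := by
  rw [refl, Module.reflection_apply]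
  rfl

theorem form_refl (hC : IsPosSimplyLaced C) (i : V) (v w : V → ℤ) :
    latticeForm C (hC.refl i v) (hC.refl i w) = latticeForm C v w := by
  simp only [refl_apply, map_sub, LinearMap.sub_apply, map_smul, LinearMap.smul_apply,
    form_simple, hC.diag, smul_eq_mul]
  rw [hC.form_comm (simple i) w]
  ring

/-- A norm 2 vector other than `±α_i` has a nonzero coordinate away from `i`. The reflection leaves
that coordinate alone, and by `nonneg_or_nonpos` it determines the sign of the whole vector. This is
the elementary step of the telescoping count. -/
theorem negInd_refl (hC : IsPosSimplyLaced C) (i : V) {v : V → ℤ}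
    (hv : latticeForm C v v = 2) :
    negInd (hC.refl i v) - negInd v =
      (if v = simple i then 1 else 0) - (if v = -simple i then 1 else 0) := by
  have hne : simple i ≠ -simple i := by
    intro h
    have := congrFun h i
    simp [simple_apply] at this
  have hrefl : hC.refl i (simple i) = -simple i := by
    rw [refl_apply, form_simple, hC.diag]
    module
  have hneg : negInd (simple i) = 0 := if_neg (not_simple_nonpos i)
  have hpos : negInd (-simple i) = 1 := by
    refine if_pos fun j => ?_
    simp only [Pi.neg_apply, simple_apply, Pi.zero_apply]
    split_ifs <;> simp
  by_cases h1 : v = simple i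
  · subst h1
    rw [hrefl, hneg, hpos, if_pos rfl, if_neg hne]
  by_cases h2 : v = -simple i
  · subst h2
    rw [map_neg, hrefl, neg_neg, hneg, hpos, if_pos rfl, if_neg hne.symm]
  rw [if_neg h1, if_neg h2]
  obtain ⟨k, hki, hk⟩ : ∃ k, k ≠ i ∧ v k ≠ 0 := by
    by_contra hcon
    push Not at hcon
    have hvi : v = v i • simple i := by
      ext k
      by_cases hk : k = i
      · subst hk; simp [simple_apply]
      · simp [simple_apply, hk, hcon k hk]
    rw [hvi] at hv
    simp only [map_smul, LinearMap.smul_apply, form_simple, hC.diag, smul_eq_mul] at hv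
    have hsq : v i * v i = 1 := by linarith
    rcases mul_self_eq_one_iff.1 hsq with h | h
    · exact h1 (by rw [hvi, h, one_smul])
    · exact h2 (by rw [hvi, h, neg_one_smul])
  have hk' : hC.refl i v k = v k := by
    rw [refl_apply]
    simp [simple_apply, hki]
  have key : ∀ u : V → ℤ, latticeForm C u u = 2 → u k ≠ 0 →
      negInd u = if u k < 0 then 1 else 0 := by
    intro u hu huk
    unfold negInd
    rcases hC.nonneg_or_nonpos hu with h | h
    · have h3 := h k
      simp only [Pi.zero_apply] at h3
      have h4 : ¬ u ≤ 0 := fun h' => by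
        have := h' k
        simp only [Pi.zero_apply] at this
        omega
      rw [if_neg h4, if_neg (by omega)]
    · have h3 := h k
      simp only [Pi.zero_apply] at h3
      rw [if_pos h, if_pos (by omega)]
  rw [key v hv hk, key _ (by rw [form_refl, hv]) (by rwa [hk']), hk']
  simp

/-- The reflections at a set of pairwise orthogonal simple roots, composed. -/
theorem exists_orthogonal_refl (hC : IsPosSimplyLaced C) (J : Finset V)
    (hJ : ∀ i ∈ J, ∀ j ∈ J, i ≠ j → C i j = 0) :
    ∃ R : (V → ℤ) ≃ₗ[ℤ] (V → ℤ),
      (∀ v w, latticeForm C (R v) (R w) = latticeForm C v w) ∧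
      (∀ v, R v = v - ∑ j ∈ J, latticeForm C v (simple j) • simple j) ∧
      ∀ v, latticeForm C v v = 2 → negInd (R.symm v) - negInd v =
        ∑ j ∈ J, ((if v = simple j then 1 else 0) - (if v = -simple j then 1 else 0)) := by
  induction J using Finset.induction_on with
  | empty => exact ⟨LinearEquiv.refl _ _, by simp, by simp, by simp⟩
  | insert i s hi ih =>
    obtain ⟨R, hR, hRv, hneg⟩ := ih fun a ha b hb =>
      hJ a (Finset.mem_insert_of_mem ha) b (Finset.mem_insert_of_mem hb)
    have hor : ∀ j ∈ s, C i j = 0 := fun j hj =>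
      hJ i (by simp) j (Finset.mem_insert_of_mem hj) (fun h => hi (h ▸ hj))
    have hRi : R (simple i) = simple i := by
      rw [hRv, Finset.sum_eq_zero, sub_zero]
      intro j hj
      rw [form_simple, hor j hj, zero_smul]
    refine ⟨(hC.refl i).trans R, ?_, ?_, ?_⟩
    · intro v w
      simp [hR, form_refl]
    · intro v
      rw [LinearEquiv.trans_apply, hC.refl_apply, map_sub, map_smul, hRi, hRv,
        Finset.sum_insert hi]
      abel
    · intro v hv
      have hu : latticeForm C (R.symm v) (R.symm v) = 2 := by
        rw [← hR, R.apply_symm_apply, hv]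
      have hrs : (hC.refl i).symm (R.symm v) = hC.refl i (R.symm v) := by
        rw [LinearEquiv.symm_apply_eq]
        exact (Module.involutive_reflection (hC.form_simple_self i) _).symm
      have h1 := hC.negInd_refl i hu
      -- By orthogonality `R` fixes `α_i`, so the test for the new reflection can be made on `v`
      -- itself.
      have e1 : R.symm v = simple i ↔ v = simple i := by
        rw [LinearEquiv.symm_apply_eq, hRi]
      have e2 : R.symm v = -simple i ↔ v = -simple i := by
        rw [LinearEquiv.symm_apply_eq, map_neg, hRi]
      simp only [e1, e2] at h1
      rw [LinearEquiv.trans_symm, LinearEquiv.trans_apply, hrs, Finset.sum_insert hi,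
        ← hneg v hv, ← h1]
      ring

end IsPosSimplyLaced

end Lattice

/-! ### The roots `γ_i` and the action of the Coxeter element -/

section Quiver

variable {V : Type*} [Fintype V] {C : Matrix V V ℤ} {Q : Digraph V} {ξ : V → ℤ}

/-- `Q` is an orientation of the graph with an edge `i - j` for every entry `C i j = -1`. -/
structure IsOrientationOf (Q : Digraph V) (C : Matrix V V ℤ) : Prop where
  adj_or_adj_iff : ∀ i j, (Q.Adj i j ∨ Q.Adj j i) ↔ C i j = -1
  asymm : ∀ i j, Q.Adj i j → ¬ Q.Adj j i

/-- The lattice vector of the root `γ_i`. -/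
noncomputable def gammaVec (Q : Digraph V) (i : V) : V → ℤ :=
  ∑ j ∈ Finset.univ.filter (fun j => Relation.ReflTransGen Q.Adj j i), simple j

theorem gammaVec_apply (Q : Digraph V) (i a : V) :
    gammaVec Q i a = if Relation.ReflTransGen Q.Adj a i then 1 else 0 := by
  simp [gammaVec, simple_apply, Finset.sum_apply]

omit [Fintype V] in
theorem IsHeightFunction.eq_or_lt (hξ : IsHeightFunction Q ξ) {a b : V}
    (h : Relation.ReflTransGen Q.Adj a b) : a = b ∨ ξ b < ξ a := by
  induction h with
  | refl => exact Or.inl rfl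
  | tail _ h ih =>
    have := hξ _ _ h
    rcases ih with rfl | ih
    · right; omega
    · right; omega

theorem IsOrientationOf.entry_eq (hC : IsPosSimplyLaced C) (hQ : IsOrientationOf Q C) (i j : V) :
    C i j = 2 * (if i = j then 1 else 0) - (if Q.Adj i j then 1 else 0)
      - (if Q.Adj j i then 1 else 0) := by
  have h := hQ.adj_or_adj_iff i j
  have h' := hQ.asymm i j
  by_cases hij : i = j
  · subst hij
    rw [hC.diag] at *
    simp at h
    simp [h]
  · rcases hC.off i j hij with h0 | h0 <;> rw [h0] at h ⊢ <;> simp at h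
    · simp [h, hij]
    · rcases h with h1 | h1
      · simp [h1, hij, h' h1]
      · have : ¬ Q.Adj i j := fun h2 => h' h2 h1
        simp [h1, hij, this]

/-- A vertex above `k` has at most one successor above `k`. -/
theorem IsOrientationOf.succ_unique (hC : IsPosSimplyLaced C) (hQ : IsOrientationOf Q C)
    {k a b₁ b₂ : V} (h₁ : Q.Adj a b₁) (h₂ : Q.Adj a b₂)
    (hk₁ : Relation.ReflTransGen Q.Adj b₁ k) (hk₂ : Relation.ReflTransGen Q.Adj b₂ k) :
    b₁ = b₂ := by
  by_contra hne
  set A := Finset.univ.filter (fun j => Relation.ReflTransGen Q.Adj j k) with hA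
  have hmem : ∀ j, j ∈ A ↔ Relation.ReflTransGen Q.Adj j k := by simp [hA]
  let out : V → ℤ := fun c => ∑ d ∈ A, if Q.Adj c d then 1 else 0
  have hpos := hC.pos (gammaVec Q k) (fun h => by
    have := congrFun h k
    simp [gammaVec_apply, Relation.ReflTransGen.refl] at this)
  -- The norm of `γ_k` is twice the Euler characteristic (vertices minus arrows) of the full
  -- subquiver on the vertices above `k`.
  have hform : latticeForm C (gammaVec Q k) (gammaVec Q k)
      = 2 * (A.card : ℤ) - 2 * ∑ c ∈ A, out c := by
    have e : latticeForm C (gammaVec Q k) (gammaVec Q k) = ∑ c ∈ A, ∑ d ∈ A, C c d := by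
      simp only [gammaVec, ← hA, map_sum, LinearMap.sum_apply, form_simple]
      rw [Finset.sum_comm]
    rw [e]
    have e2 : ∑ c ∈ A, ∑ d ∈ A, (if Q.Adj d c then (1 : ℤ) else 0) = ∑ c ∈ A, out c :=
      Finset.sum_comm
    have e3 : ∑ c ∈ A, ∑ d ∈ A, (2 * (if c = d then (1 : ℤ) else 0)) = 2 * (A.card : ℤ) := by
      simp [Finset.sum_ite_eq, mul_comm]
    calc ∑ c ∈ A, ∑ d ∈ A, C c d = ∑ c ∈ A, ∑ d ∈ A, (2 * (if c = d then (1 : ℤ) else 0))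
        - ∑ c ∈ A, out c - ∑ c ∈ A, ∑ d ∈ A, (if Q.Adj d c then (1 : ℤ) else 0) := by
          simp only [out, ← Finset.sum_sub_distrib]
          exact Finset.sum_congr rfl fun c _ => Finset.sum_congr rfl fun d _ =>
            hQ.entry_eq hC c d
      _ = _ := by rw [e2, e3]; ring
  -- Every vertex of `A` except `k` has an arrow inside `A`, and `a` would have an extra one. That
  -- makes at least `|A|` arrows, so the norm would not be positive.
  have hout : ∀ c ∈ A, 1 + (if c = a then 1 else 0) - (if c = k then 1 else 0) ≤ out c := by
    intro c hc
    have h0 : 0 ≤ out c := Finset.sum_nonneg fun d _ => by split_ifs <;> simp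
    by_cases hca : c = a
    · subst hca
      have : (2 : ℤ) ≤ out c := by
        calc (2 : ℤ) = ∑ d ∈ ({b₁, b₂} : Finset V), if Q.Adj c d then 1 else 0 := by
              rw [Finset.sum_pair hne, if_pos h₁, if_pos h₂]; rfl
          _ ≤ out c := by
              refine Finset.sum_le_sum_of_subset_of_nonneg ?_ fun d _ _ => by split_ifs <;> simp
              intro d hd
              rcases Finset.mem_insert.1 hd with rfl | hd
              · exact (hmem _).2 hk₁
              · rw [Finset.mem_singleton.1 hd]; exact (hmem _).2 hk₂
      split_ifs <;> omega
    · by_cases hck : c = k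
      · subst hck
        simp [hca, h0]
      · obtain ⟨d, hcd, hdk⟩ := ((hmem c).1 hc).cases_head.resolve_left hck
        have : (1 : ℤ) ≤ out c := by
          calc (1 : ℤ) = if Q.Adj c d then 1 else 0 := by rw [if_pos hcd]
            _ ≤ out c := Finset.single_le_sum (f := fun d => if Q.Adj c d then (1 : ℤ) else 0)
              (fun d _ => by split_ifs <;> simp) ((hmem d).2 hdk)
        simp [hca, hck, this]
  have haA : a ∈ A := (hmem a).2 (Relation.ReflTransGen.head h₁ hk₁)
  have hkA : k ∈ A := (hmem k).2 Relation.ReflTransGen.refl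
  have hsum := Finset.sum_le_sum hout
  simp only [Finset.sum_sub_distrib, Finset.sum_add_distrib, Finset.sum_ite_eq', haA, hkA,
    if_true, Finset.sum_const, nsmul_eq_mul, mul_one] at hsum
  rw [hform] at hpos
  linarith

/-- Paths from `a` through `i` and through `i'` both continue to `k`, so by `succ_unique` they agree
arrow by arrow. Since `i` and `i'` have equal height, the paths reach them at the same step. -/
theorem IsOrientationOf.pred_unique (hC : IsPosSimplyLaced C) (hQ : IsOrientationOf Q C)
    (hξ : IsHeightFunction Q ξ) {k i i' a : V} (hi : Q.Adj i k) (hi' : Q.Adj i' k)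
    (ha : Relation.ReflTransGen Q.Adj a i) (ha' : Relation.ReflTransGen Q.Adj a i') :
    i = i' := by
  have hξi : ξ i = ξ i' := by
    have := hξ _ _ hi
    have := hξ _ _ hi'
    omega
  induction ha using Relation.ReflTransGen.head_induction_on with
  | refl =>
    rcases hξ.eq_or_lt ha' with h | h
    · exact h
    · omega
  | head hab hbi ih =>
    rename_i c d
    rcases ha'.cases_head with rfl | ⟨d', hcd', hd'⟩
    · rcases hξ.eq_or_lt (Relation.ReflTransGen.head hab hbi) with h | h
      · exact h.symm
      · omega
    · have : d = d' := hQ.succ_unique hC hab hcd' (hbi.tail hi) (hd'.tail hi')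
      subst this
      exact ih hd'

/-- The vertices strictly above `k` split as a disjoint union according to the predecessor of `k`
through which they pass; disjointness is `pred_unique`. -/
theorem IsOrientationOf.gammaVec_eq (hC : IsPosSimplyLaced C) (hQ : IsOrientationOf Q C)
    (hξ : IsHeightFunction Q ξ) (k : V) :
    gammaVec Q k = simple k + ∑ i, if Q.Adj i k then gammaVec Q i else 0 := by
  ext a
  have e : (∑ i, if Q.Adj i k then gammaVec Q i else 0) a =
      ∑ i, if Q.Adj i k ∧ Relation.ReflTransGen Q.Adj a i then (1 : ℤ) else 0 := by
    rw [Finset.sum_apply]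
    refine Finset.sum_congr rfl fun i _ => ?_
    by_cases h : Q.Adj i k <;> simp [h, gammaVec_apply]
  rw [Pi.add_apply, e, gammaVec_apply, simple_apply]
  by_cases hak : a = k
  · subst hak
    rw [if_pos Relation.ReflTransGen.refl, if_pos rfl, Finset.sum_eq_zero, add_zero]
    rintro i -
    refine if_neg ?_
    rintro ⟨h1, h2⟩
    have := hξ _ _ h1
    rcases hξ.eq_or_lt h2 with rfl | h
    · omega
    · omega
  · rw [if_neg hak, zero_add]
    by_cases h : Relation.ReflTransGen Q.Adj a k
    · obtain ⟨i, hai, hik⟩ := h.cases_tail.resolve_left (fun h => hak h.symm)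
      rw [if_pos h, Finset.sum_eq_single i, if_pos ⟨hik, hai⟩]
      · rintro i' - hne
        refine if_neg ?_
        rintro ⟨h1, h2⟩
        exact hne (hQ.pred_unique hC hξ h1 hik h2 hai)
      · simp
    · rw [if_neg h, Finset.sum_eq_zero]
      rintro i -
      refine if_neg ?_
      rintro ⟨h1, h2⟩
      exact h (h2.tail h1)

/-- The Coxeter element of a word, acting on the root lattice. -/
noncomputable def IsPosSimplyLaced.wordProd (hC : IsPosSimplyLaced C) (l : List V) :
    (V → ℤ) ≃ₗ[ℤ] (V → ℤ) :=
  (l.map hC.refl).prod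

/-- The quiver obtained from `Q` by reversing the arrows that join `S` to its complement. -/
def reverseAlong (Q : Digraph V) (S : Set V) : Digraph V where
  Adj a b := if (a ∈ S ↔ b ∈ S) then Q.Adj a b else Q.Adj b a

omit [Fintype V] in
theorem reflectAt_reverseAlong (Q : Digraph V) (S : Set V) {i : V} (hi : i ∉ S)
    (hQ : ∀ a, ¬ Q.Adj a a) :
    reflectAt (reverseAlong Q S) i = reverseAlong Q (insert i S) := by
  ext a b
  by_cases ha : a = i
  · subst ha
    by_cases hb : b = a
    · subst hb; simp [reflectAt, reverseAlong, hQ]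
    · by_cases hbS : b ∈ S <;> simp [reflectAt, reverseAlong, hi, hb, hbS]
  · by_cases hb : b = i
    · subst hb
      by_cases haS : a ∈ S <;> simp [reflectAt, reverseAlong, hi, ha, haS]
    · simp [reflectAt, reverseAlong, ha, hb]

theorem refl_simple_eq (hC : IsPosSimplyLaced C) (hQ : IsOrientationOf Q C) (i k : V) :
    hC.refl i (simple k) = if k = i then -simple i else
      simple k + (if Q.Adj i k then simple i else 0) + (if Q.Adj k i then simple i else 0) := by
  rw [hC.refl_apply, form_simple, hQ.entry_eq hC]
  by_cases hki : k = i
  · subst hki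
    have : ¬ Q.Adj k k := fun h => hQ.asymm _ _ h h
    simp only [this, if_true, if_false]
    module
  · by_cases h1 : Q.Adj i k <;> by_cases h2 : Q.Adj k i <;> simp [hki, h1, h2]
    exact absurd h2 (hQ.asymm _ _ h1)

/-- The image of `α_k` under the product of the reflections along an adapted word with letters
`S`. -/
noncomputable def partialCoxeterVec (Q : Digraph V) (S : Set V) (k : V) : V → ℤ :=
  if k ∈ S then -gammaVec Q k + ∑ j, (if Q.Adj k j ∧ j ∈ S then gammaVec Q j else 0)
  else simple k + ∑ j, (if Q.Adj j k ∧ j ∈ S then gammaVec Q j else 0)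

/-- `S` holds the letters already used and `w` is their product. Keeping track of the images of all
simple roots, not just of the next letter, makes the induction close. At each step the next letter
`i` satisfies `w α_i = γ_i`. -/
theorem wordProd_adapted (hC : IsPosSimplyLaced C) (hQ : IsOrientationOf Q C)
    (hξ : IsHeightFunction Q ξ) (l : List V) :
    ∀ (S : Set V) (w : (V → ℤ) ≃ₗ[ℤ] (V → ℤ)), l.Nodup → (∀ i ∈ l, i ∉ S) →
      IsAdapted (reverseAlong Q S) l →
      (∀ k, w (simple k) = partialCoxeterVec Q S k) →
      ∀ k, (w * hC.wordProd l) (simple k) = partialCoxeterVec Q (S ∪ {i | i ∈ l}) k := by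
  induction l with
  | nil =>
    intro S w _ _ _ hw k
    simpa [IsPosSimplyLaced.wordProd] using hw k
  | cons i l ih =>
    intro S w hnd hS had hw k
    have hiS : i ∉ S := hS i (by simp)
    have hirr : ∀ a, ¬ Q.Adj a a := fun a h => hQ.asymm _ _ h h
    rw [List.nodup_cons] at hnd
    -- Being a source after the reversals means that, in `Q`, all predecessors of `i` are in `S` and
    -- none of its successors is.
    have hsrc : ∀ a, (a ∈ S → ¬ Q.Adj i a) ∧ (a ∉ S → ¬ Q.Adj a i) := by
      intro a
      have := had.1 a
      refine ⟨fun h => ?_, fun h => ?_⟩ <;> simpa [reverseAlong, h, hiS] using this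
    have hwi : w (simple i) = gammaVec Q i := by
      rw [hw i, partialCoxeterVec, if_neg hiS, hQ.gammaVec_eq hC hξ i]
      congr 1
      refine Finset.sum_congr rfl fun j _ => ?_
      by_cases hj : j ∈ S
      · simp [hj]
      · simp [hj, (hsrc j).2 hj]
    have hadd : ∀ (p : V → Prop) (S' : Set V), S' = insert i S →
        ∑ j, (if p j ∧ j ∈ S' then gammaVec Q j else 0) =
        ∑ j, (if p j ∧ j ∈ S then gammaVec Q j else 0) + if p i then gammaVec Q i else 0 := by
      rintro p S' rfl
      have : (if p i then gammaVec Q i else 0) =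
          ∑ j, if j = i then (if p i then gammaVec Q i else 0) else 0 := by simp
      rw [this, ← Finset.sum_add_distrib]
      refine Finset.sum_congr rfl fun j _ => ?_
      by_cases hj : j = i
      · subst hj; simp [hiS]
      · simp [hj]
    have h := ih (insert i S) (w * hC.refl i) hnd.2 ?_ ?_ ?_ k
    · have hset : insert i S ∪ {j | j ∈ l} = S ∪ {j | j ∈ i :: l} := by
        ext a; simp; tauto
      rw [hset] at h
      simpa [IsPosSimplyLaced.wordProd, mul_assoc] using h
    · intro j hj hj'
      rcases hj' with rfl | hj'
      · exact hnd.1 hj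
      · exact hS j (by simp [hj]) hj'
    · rw [← reflectAt_reverseAlong Q S hiS hirr]
      exact had.2
    · intro k
      obtain ⟨S', hS'⟩ : ∃ S', S' = insert i S := ⟨_, rfl⟩
      rw [LinearEquiv.mul_apply, refl_simple_eq hC hQ, ← hS', partialCoxeterVec,
        hadd _ S' hS', hadd _ S' hS']
      by_cases hki : k = i
      · subst hki
        rw [if_pos rfl, map_neg, hwi, if_pos (by simp [hS']), if_neg (hirr k), add_zero,
          Finset.sum_eq_zero, add_zero]
        rintro j -
        refine if_neg ?_
        rintro ⟨h1, h2⟩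
        exact (hsrc j).1 h2 h1
      · have hmem : k ∈ S' ↔ k ∈ S := by simp [hS', hki]
        rw [if_neg hki, map_add, map_add, apply_ite w, apply_ite w, map_zero, hwi, hw k,
          partialCoxeterVec]
        simp only [hmem]
        by_cases hk : k ∈ S
        · rw [if_pos hk, if_pos hk, if_neg ((hsrc k).1 hk)]
          abel
        · rw [if_neg hk, if_neg hk, if_neg ((hsrc k).2 hk)]
          abel

/-- The Coxeter element maps `α_k` to `-γ_k + ∑_{k → j} γ_j`. -/
theorem wordProd_simple (hC : IsPosSimplyLaced C) (hQ : IsOrientationOf Q C)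
    (hξ : IsHeightFunction Q ξ) {l : List V} (hl : IsCoxeterWord Q l) (k : V) :
    hC.wordProd l (simple k) =
      -gammaVec Q k + ∑ j, if Q.Adj k j then gammaVec Q j else 0 := by
  have hQ0 : reverseAlong Q ∅ = Q := by
    ext a b; simp [reverseAlong]
  have h := wordProd_adapted hC hQ hξ l ∅ 1 hl.1 (by simp) (by rw [hQ0]; exact hl.2.2)
    (by simp [partialCoxeterVec]) k
  simpa [partialCoxeterVec, hl.2.1] using h

/-- Apply `τ` to `γ_k = α_k + ∑_{i → k} γ_i` and substitute the value of `τ α_k`. This is the mesh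
relation at the top level; powers of `τ` carry it to all lower ones. -/
theorem wordProd_gammaVec (hC : IsPosSimplyLaced C) (hQ : IsOrientationOf Q C)
    (hξ : IsHeightFunction Q ξ) {l : List V} (hl : IsCoxeterWord Q l) (k : V) :
    gammaVec Q k + hC.wordProd l (gammaVec Q k) =
      ∑ j, ((if Q.Adj k j then gammaVec Q j else 0) +
        (if Q.Adj j k then hC.wordProd l (gammaVec Q j) else 0)) := by
  conv_lhs => rw [hQ.gammaVec_eq hC hξ k]
  rw [map_add, wordProd_simple hC hQ hξ hl, ← hQ.gammaVec_eq hC hξ k, map_sum,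
    Finset.sum_add_distrib]
  simp only [apply_ite (hC.wordProd l), map_zero]
  abel

end Quiver

/-! ### Truncated products of reflections and the exponent of a root -/

section RootSequence

variable {V : Type*} [Fintype V] {C : Matrix V V ℤ} {Q : Digraph V} {ξ : V → ℤ} {l : List V}

/-- The lattice vector `τ ^ m γ_k` at the place `(k, s)`, `s = ξ k - 2 m`: the root `β_{k,s}` up to
sign. -/
noncomputable def rootAt (hC : IsPosSimplyLaced C) (Q : Digraph V) (ξ : V → ℤ) (l : List V)
    (k : V) (s : ℤ) : V → ℤ :=
  (hC.wordProd l ^ ((ξ k - s) / 2).toNat) (gammaVec Q k)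

theorem rootAt_height (hC : IsPosSimplyLaced C) (k : V) :
    rootAt hC Q ξ l k (ξ k) = gammaVec Q k := by
  simp [rootAt]

theorem rootAt_eq (hC : IsPosSimplyLaced C) {k : V} {s : ℤ} (m : ℕ) (h : s = ξ k - 2 * m) :
    rootAt hC Q ξ l k s = (hC.wordProd l ^ m) (gammaVec Q k) := by
  have : ((ξ k - s) / 2).toNat = m := by omega
  rw [rootAt, this]

omit [Fintype V] in
theorem height_of_entry (hQ : IsOrientationOf Q C) (hξ : IsHeightFunction Q ξ) {j k : V}
    (h : C j k = -1) : (Q.Adj j k ∧ ξ j = ξ k + 1) ∨ (Q.Adj k j ∧ ξ j = ξ k - 1) := by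
  rcases (hQ.adj_or_adj_iff j k).2 h with h | h
  · have := hξ _ _ h
    exact Or.inl ⟨h, by omega⟩
  · exact Or.inr ⟨h, hξ _ _ h⟩

/-- The mesh relation. -/
theorem rootAt_add_rootAt (hC : IsPosSimplyLaced C) (hQ : IsOrientationOf Q C)
    (hξ : IsHeightFunction Q ξ) (hl : IsCoxeterWord Q l) {k : V} {s : ℤ} (m : ℕ)
    (h : s = ξ k - 2 * m) :
    rootAt hC Q ξ l k s + rootAt hC Q ξ l k (s - 2) =
      ∑ j, if C j k = -1 then rootAt hC Q ξ l j (s - 1) else 0 := by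
  rw [rootAt_eq hC m h, rootAt_eq hC (m + 1) (by push_cast; omega), pow_succ,
    LinearEquiv.mul_apply, ← map_add, wordProd_gammaVec hC hQ hξ hl, map_sum]
  refine Finset.sum_congr rfl fun j _ => ?_
  by_cases hj : C j k = -1
  · rw [if_pos hj]
    rcases height_of_entry hQ hξ hj with ⟨h1, h2⟩ | ⟨h1, h2⟩
    · rw [if_pos h1, if_neg (hQ.asymm _ _ h1), zero_add,
        rootAt_eq hC (m + 1) (by push_cast; omega), pow_succ, LinearEquiv.mul_apply]
    · rw [if_pos h1, if_neg (hQ.asymm _ _ h1), add_zero, rootAt_eq hC m (by omega)]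
  · have h1 : ¬ Q.Adj j k := fun h => hj ((hQ.adj_or_adj_iff j k).1 (Or.inl h))
    have h2 : ¬ Q.Adj k j := fun h => hj ((hQ.adj_or_adj_iff j k).1 (Or.inr h))
    rw [if_neg h1, if_neg h2, if_neg hj]
    simp

/-- The image of `α_k` under the product of the reflections at all places `(j, s)` with `s > t`. -/
noncomputable def truncatedVec (hC : IsPosSimplyLaced C) (Q : Digraph V) (ξ : V → ℤ) (l : List V)
    (t : ℤ) (k : V) : V → ℤ :=
  if ξ k < t then simple k
  else if 2 ∣ ξ k - t then rootAt hC Q ξ l k t else -rootAt hC Q ξ l k (t + 1)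

/-- `1`, `-1` or `0` according to whether the lattice vector at the place `(j, s)` of `I^{≤ξ}` is
`β`, `-β` or neither. -/
noncomputable def signAt (hC : IsPosSimplyLaced C) (Q : Digraph V) (ξ : V → ℤ) (l : List V)
    (β : V → ℤ) (s : ℤ) (j : V) : ℤ :=
  if s ≤ ξ j ∧ 2 ∣ ξ j - s then
    (if rootAt hC Q ξ l j s = β then 1 else 0) - (if rootAt hC Q ξ l j s = -β then 1 else 0)
  else 0

/-- The reflections at level `t` sit at places of equal parity, hence at pairwise non-adjacent
vertices. If `(k,t)` is a place, only `k` contributes and the vector changes sign. Otherwise the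
neighbours of `k` contribute: nothing when `ξ k < t - 1`, the recursion for `γ_k` when `ξ k = t -
1`, and the mesh relation when `ξ k > t`. -/
theorem truncatedVec_step (hC : IsPosSimplyLaced C) (hQ : IsOrientationOf Q C)
    (hξ : IsHeightFunction Q ξ) (hl : IsCoxeterWord Q l) (t : ℤ) (k : V) :
    truncatedVec hC Q ξ l t k -
      ∑ j ∈ Finset.univ.filter (fun j => t ≤ ξ j ∧ 2 ∣ ξ j - t), C k j • rootAt hC Q ξ l j t =
    truncatedVec hC Q ξ l (t - 1) k := by
  by_cases hk : t ≤ ξ k ∧ 2 ∣ ξ k - t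
  · rw [Finset.sum_eq_single k]
    · rw [truncatedVec, truncatedVec, if_neg (by omega), if_pos hk.2, if_neg (by omega),
        if_neg (by omega), hC.diag, sub_add_cancel]
      module
    · intro j hj hjk
      rw [Finset.mem_filter] at hj
      rcases hC.off k j hjk.symm with h | h
      · rw [h, zero_smul]
      · rcases height_of_entry hQ hξ h with h | h <;> omega
    · simp [hk]
  · have e : ∑ j ∈ Finset.univ.filter (fun j => t ≤ ξ j ∧ 2 ∣ ξ j - t),
        C k j • rootAt hC Q ξ l j t =
        -∑ j, if C j k = -1 ∧ t ≤ ξ j then rootAt hC Q ξ l j t else 0 := by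
      rw [Finset.sum_filter, ← Finset.sum_neg_distrib]
      refine Finset.sum_congr rfl fun j _ => ?_
      by_cases hjk : C j k = -1
      · have h := height_of_entry hQ hξ hjk
        by_cases hj : t ≤ ξ j
        · rw [if_pos ⟨hj, by omega⟩, if_pos ⟨hjk, hj⟩, hC.symm, hjk, neg_one_smul]
        · rw [if_neg (fun h => hj h.1), if_neg (fun h => hj h.2), neg_zero]
      · rw [if_neg (c := C j k = -1 ∧ t ≤ ξ j) (fun h => hjk h.1), neg_zero]
        split_ifs with hj
        · have hne : k ≠ j := by rintro rfl; exact hk hj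
          rcases hC.off k j hne with h | h
          · rw [h, zero_smul]
          · exact absurd (hC.symm j k ▸ h) hjk
        · rfl
    rw [e, sub_neg_eq_add]
    rcases lt_trichotomy (ξ k) (t - 1) with h | h | h
    · rw [truncatedVec, truncatedVec, if_pos (by omega), if_pos h, Finset.sum_eq_zero, add_zero]
      rintro j -
      refine if_neg ?_
      rintro ⟨hjk, hj⟩
      have := height_of_entry hQ hξ hjk
      omega
    · have h2 : (2 : ℤ) ∣ ξ k - (t - 1) := by omega
      rw [truncatedVec, truncatedVec, if_pos (by omega), if_neg (by omega), if_pos h2, ← h,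
        rootAt_height, hQ.gammaVec_eq hC hξ k]
      congr 1
      refine Finset.sum_congr rfl fun j _ => ?_
      by_cases hjk : C j k = -1
      · rcases height_of_entry hQ hξ hjk with h' | h'
        · rw [if_pos h'.1, if_pos ⟨hjk, by omega⟩, show t = ξ j by omega, rootAt_height]
        · rw [if_neg (hQ.asymm _ _ h'.1), if_neg (fun h => by omega)]
      · rw [if_neg (fun h => hjk h.1),
          if_neg (fun h => hjk ((hQ.adj_or_adj_iff j k).1 (Or.inl h)))]
    · have hm := rootAt_add_rootAt hC hQ hξ hl (k := k) (s := t + 1) ((ξ k - (t + 1)) / 2).toNat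
        (by omega)
      rw [show t + 1 - 2 = t - 1 by ring, show t + 1 - 1 = t by ring] at hm
      rw [truncatedVec, truncatedVec, if_neg (by omega), if_neg (by omega), if_neg (by omega),
        if_pos (by omega), eq_comm, ← sub_eq_iff_eq_add', sub_neg_eq_add, add_comm, hm]
      refine Finset.sum_congr rfl fun j _ => ?_
      by_cases hjk : C j k = -1
      · have := height_of_entry hQ hξ hjk
        rw [if_pos hjk, if_pos ⟨hjk, by omega⟩]
      · rw [if_neg hjk, if_neg (fun h => hjk h.1)]

/-- Induction on levels, starting at a `T` above all heights, where no reflection has been made and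
`β ≥ 0` has indicator 0. Passing level `t` replaces `w⁻¹β` by `R⁻¹w⁻¹β`. Since `w α_j = v_{j,t}`,
meeting `±α_j` means `v_{j,t} = ±β`, and the sign changes sum to the final indicator. -/
theorem exists_truncated (hC : IsPosSimplyLaced C) (hQ : IsOrientationOf Q C)
    (hξ : IsHeightFunction Q ξ) (hl : IsCoxeterWord Q l) {T : ℤ} (hT : ∀ k, ξ k < T) (N : ℕ) :
    ∃ w : (V → ℤ) ≃ₗ[ℤ] (V → ℤ),
      (∀ u v, latticeForm C (w u) (w v) = latticeForm C u v) ∧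
      (∀ k, w (simple k) = truncatedVec hC Q ξ l (T - N) k) ∧
      ∀ β, latticeForm C β β = 2 → 0 ≤ β → negInd (w.symm β) =
        ∑ n ∈ Finset.range N, ∑ j, signAt hC Q ξ l β (T - n) j := by
  induction N with
  | zero =>
    refine ⟨LinearEquiv.refl _ _, by simp, fun k => ?_, fun β hβ hpos => ?_⟩
    · simp [truncatedVec, hT]
    · simp only [LinearEquiv.refl_symm, LinearEquiv.refl_apply, Finset.range_zero,
        Finset.sum_empty]
      refine if_neg fun h => ?_
      rw [le_antisymm h hpos] at hβ
      simp at hβ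
  | succ N ih =>
    obtain ⟨w, hw, hws, hneg⟩ := ih
    set t : ℤ := T - N with ht
    set J := Finset.univ.filter (fun j => t ≤ ξ j ∧ 2 ∣ ξ j - t) with hJ
    have hJm : ∀ j, j ∈ J ↔ t ≤ ξ j ∧ 2 ∣ ξ j - t := by simp [hJ]
    obtain ⟨R, hR, hRv, hRneg⟩ := hC.exists_orthogonal_refl J (by
      intro i hi j hj hij
      rw [hJm] at hi hj
      rcases hC.off i j hij with h | h
      · exact h
      · rcases height_of_entry hQ hξ h with h | h <;> omega)
    have hwJ : ∀ j ∈ J, w (simple j) = rootAt hC Q ξ l j t := by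
      intro j hj
      rw [hJm] at hj
      rw [hws, truncatedVec, if_neg (by omega), if_pos hj.2]
    refine ⟨R.trans w, fun u v => ?_, fun k => ?_, fun β hβ hpos => ?_⟩
    · simp [hw, hR]
    · have : T - ((N + 1 : ℕ) : ℤ) = t - 1 := by push_cast; omega
      rw [this, ← truncatedVec_step hC hQ hξ hl, LinearEquiv.trans_apply, hRv, map_sub, hws,
        map_sum]
      congr 1
      refine Finset.sum_congr rfl fun j hj => ?_
      rw [form_simple, map_smul, hwJ j hj]
    · have hu : latticeForm C (w.symm β) (w.symm β) = 2 := by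
        rw [← hw, w.apply_symm_apply, hβ]
      have h1 := hRneg _ hu
      have h2 : ∑ j ∈ J, ((if w.symm β = simple j then (1 : ℤ) else 0) -
          (if w.symm β = -simple j then 1 else 0)) = ∑ j, signAt hC Q ξ l β t j := by
        rw [hJ, Finset.sum_filter]
        refine Finset.sum_congr rfl fun j _ => ?_
        rw [signAt]
        by_cases hj : t ≤ ξ j ∧ 2 ∣ ξ j - t
        · rw [if_pos hj, if_pos hj]
          have e1 : w.symm β = simple j ↔ rootAt hC Q ξ l j t = β := by
            rw [LinearEquiv.symm_apply_eq, hwJ j ((hJm j).2 hj), eq_comm]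
          have e2 : w.symm β = -simple j ↔ rootAt hC Q ξ l j t = -β := by
            rw [LinearEquiv.symm_apply_eq, map_neg, hwJ j ((hJm j).2 hj), eq_comm, neg_eq_iff_eq_neg]
          simp only [e1, e2]
        · rw [if_neg hj, if_neg hj]
      rw [LinearEquiv.trans_symm, LinearEquiv.trans_apply, Finset.sum_range_succ, ← hneg β hβ hpos,
        ← h2, ← h1]
      ring

/-- Both sides obey the mesh recursion, so only two initial levels need checking. The formula does
not extend to level `p`: there the pairing of `v_{i,p}` with itself is 2, whereas `c i 1 - c i (-1)
= 1`. -/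
theorem form_rootAt_eq (hC : IsPosSimplyLaced C) (hQ : IsOrientationOf Q C)
    (hξ : IsHeightFunction Q ξ) (hl : IsCoxeterWord Q l) {i : V} {p : ℤ}
    (hi : p ≤ ξ i) (hi2 : 2 ∣ ξ i - p) {w : (V → ℤ) ≃ₗ[ℤ] (V → ℤ)}
    (hw : ∀ u v, latticeForm C (w u) (w v) = latticeForm C u v)
    (hws : ∀ k, w (simple k) = truncatedVec hC Q ξ l p k) {c : V → ℤ → ℤ}
    (hc0 : ∀ j m, m ≤ 0 → c j m = 0) (hc1 : ∀ j, c j 1 = if i = j then 1 else 0)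
    (hcs : ∀ j m, 1 ≤ m → c j (m + 1) + c j (m - 1) = ∑ k, if C k j = -1 then c k m else 0)
    (n : ℕ) : ∀ j, p + 1 + n ≤ ξ j → 2 ∣ ξ j - (p + 1 + n) →
      latticeForm C (rootAt hC Q ξ l i p) (rootAt hC Q ξ l j (p + 1 + n)) =
        c j (n + 2) - c j n := by
  have hwi : w (simple i) = rootAt hC Q ξ l i p := by
    rw [hws, truncatedVec, if_neg (by omega), if_pos hi2]
  have h0 : ∀ j, p ≤ ξ j → 2 ∣ ξ j - p →
      latticeForm C (rootAt hC Q ξ l i p) (rootAt hC Q ξ l j p) =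
        if i = j then 2 else 0 := by
    intro j hj hj2
    have hwj : w (simple j) = rootAt hC Q ξ l j p := by
      rw [hws, truncatedVec, if_neg (by omega), if_pos hj2]
    rw [← hwi, ← hwj, hw, form_simple]
    by_cases hij : i = j
    · rw [if_pos hij, hij, hC.diag]
    · rw [if_neg hij]
      rcases hC.off i j hij with h | h
      · exact h
      · rcases height_of_entry hQ hξ h with h | h <;> omega
  have hmesh : ∀ j s, s + 2 ≤ ξ j → 2 ∣ ξ j - s →
      latticeForm C (rootAt hC Q ξ l i p) (rootAt hC Q ξ l j (s + 2)) +
      latticeForm C (rootAt hC Q ξ l i p) (rootAt hC Q ξ l j s) =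
      ∑ k, if C k j = -1
        then latticeForm C (rootAt hC Q ξ l i p) (rootAt hC Q ξ l k (s + 1)) else 0 := by
    intro j s hs hs2
    have h := rootAt_add_rootAt hC hQ hξ hl (k := j) (s := s + 2) ((ξ j - (s + 2)) / 2).toNat
      (by omega)
    have e1 : s + 2 - 2 = s := by ring
    have e2 : s + 2 - 1 = s + 1 := by ring
    rw [e1, e2] at h
    rw [← map_add, h, map_sum]
    refine Finset.sum_congr rfl fun k _ => ?_
    split_ifs <;> simp
  induction n using Nat.strong_induction_on with
  | _ n ih =>
    intro j hj hj2
    rcases n with _ | _ | n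
    -- Level `p + 1`: here `v_{j,p+1} = -w α_j`, so the pairing is `-C i j`, which is also `c j 2`.
    · have hwj : w (simple j) = -rootAt hC Q ξ l j (p + 1) := by
        rw [hws, truncatedVec, if_neg (by push_cast at *; omega),
          if_neg (by push_cast at *; omega)]
      have h := hcs j 1 le_rfl
      have hij : i ≠ j := by rintro rfl; push_cast at *; omega
      simp only [hc1] at h
      norm_num at h
      rw [hc0 j 0 le_rfl, add_zero] at h
      have e : rootAt hC Q ξ l j (p + 1) = -w (simple j) := by rw [hwj, neg_neg]
      push_cast
      rw [add_zero, e, ← hwi, map_neg, hw, form_simple, hc0 j 0 le_rfl, h]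
      have : ∀ k, (if C k j = -1 then (if i = k then (1 : ℤ) else 0) else 0)
          = if k = i then (if C i j = -1 then 1 else 0) else 0 := by
        intro k
        by_cases hk : k = i
        · subst hk; simp
        · simp [hk, Ne.symm hk]
      simp only [this, Finset.sum_ite_eq', Finset.mem_univ, if_true]
      rcases hC.off i j hij with h' | h' <;> simp [h']
    -- Level `p + 2`: the mesh relation gives `c j 3 + c j 1` minus the level `p` pairing `2 * c j
    -- 1`, which is the required difference.
    · have h := hmesh j p (by push_cast at hj; omega) (by push_cast at hj2; omega)
      rw [h0 j (by push_cast at hj; omega) (by push_cast at hj2; omega)] at h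
      have hc := hcs j 2 (by norm_num)
      norm_num at hc
      have e : ∑ k, (if C k j = -1
          then latticeForm C (rootAt hC Q ξ l i p) (rootAt hC Q ξ l k (p + 1)) else 0) =
          ∑ k, if C k j = -1 then c k 2 else 0 := by
        refine Finset.sum_congr rfl fun k _ => ?_
        by_cases hkj : C k j = -1
        · rw [if_pos hkj, if_pos hkj]
          have hk := height_of_entry hQ hξ hkj
          have := ih 0 (by omega) k (by push_cast at *; omega) (by push_cast at *; omega)
          push_cast at this
          rw [add_zero, hc0 k 0 le_rfl, sub_zero] at this
          exact this
        · rw [if_neg hkj, if_neg hkj]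
      rw [e, ← hc, hc1] at h
      have e3 : p + 1 + ((0 + 1 : ℕ) : ℤ) = p + 2 := by push_cast; ring
      rw [e3]
      push_cast
      rw [hc1]
      split_ifs at h ⊢ <;> omega
    · have h := hmesh j (p + 1 + n) (by push_cast at hj; omega) (by push_cast at hj2; omega)
      rw [ih n (by omega) j (by push_cast at hj; omega) (by push_cast at hj2; omega)] at h
      have hc3 := hcs j (n + 3) (by omega)
      have hc1' := hcs j (n + 1) (by omega)
      have e : ∑ k, (if C k j = -1
          then latticeForm C (rootAt hC Q ξ l i p) (rootAt hC Q ξ l k (p + 1 + n + 1))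
          else 0) =
          (∑ k, if C k j = -1 then c k (n + 3) else 0) -
            ∑ k, if C k j = -1 then c k (n + 1) else 0 := by
        rw [← Finset.sum_sub_distrib]
        refine Finset.sum_congr rfl fun k _ => ?_
        by_cases hkj : C k j = -1
        · rw [if_pos hkj, if_pos hkj, if_pos hkj]
          have hk := height_of_entry hQ hξ hkj
          have := ih (n + 1) (by omega) k (by push_cast at *; omega) (by push_cast at *; omega)
          push_cast at this
          rw [show p + 1 + (n : ℤ) + 1 = p + 1 + (n + 1) by ring, this]
          congr 2
        · rw [if_neg hkj, if_neg hkj, if_neg hkj, sub_zero]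
      rw [e, ← hc3, ← hc1'] at h
      push_cast
      rw [show (n : ℤ) + 3 + 1 = n + 1 + 1 + 2 by ring, show (n : ℤ) + 3 - 1 = n + 2 by ring,
        show (n : ℤ) + 1 + 1 = n + 2 by ring, show (n : ℤ) + 1 - 1 = n by ring] at h
      rw [show p + 1 + ((n : ℤ) + 1 + 1) = p + 1 + n + 2 by ring,
        show (n : ℤ) + 1 + 1 = n + 2 by ring]
      linarith

/-- The total exponent of `±β` in the product is at most `1` in absolute value. -/
theorem abs_sum_exponent_le (hC : IsPosSimplyLaced C) (hQ : IsOrientationOf Q C)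
    (hξ : IsHeightFunction Q ξ) (hl : IsCoxeterWord Q l) {i : V} {p : ℤ}
    (hi : p ≤ ξ i) (hi2 : 2 ∣ ξ i - p) {T : ℤ} (hT : ∀ k, ξ k < T) {N : ℕ} (hN : T - N = p)
    {c : V → ℤ → ℤ}
    (hc0 : ∀ j m, m ≤ 0 → c j m = 0) (hc1 : ∀ j, c j 1 = if i = j then 1 else 0)
    (hcs : ∀ j m, 1 ≤ m → c j (m + 1) + c j (m - 1) = ∑ k, if C k j = -1 then c k m else 0)
    {β : V → ℤ} (hβ : latticeForm C β β = 2) (hpos : 0 ≤ β) :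
    |∑ n ∈ Finset.range (N + 1), ∑ j, if (T - n ≤ ξ j ∧ 2 ∣ ξ j - (T - n)) ∧
        (rootAt hC Q ξ l j (T - n) = β ∨ rootAt hC Q ξ l j (T - n) = -β)
      then c j (T - n - p - 1) - c j (T - n - p + 1) else 0| ≤ 1 := by
  obtain ⟨w, hw, hws, hneg⟩ := exists_truncated hC hQ hξ hl hT N
  rw [hN] at hws
  have hwi : w (simple i) = rootAt hC Q ξ l i p := by
    rw [hws, truncatedVec, if_neg (by omega), if_pos hi2]
  have hββ : β ≠ -β := by
    intro h
    have := congrArg (latticeForm C β) h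
    rw [map_neg] at this
    omega
  -- Above level `p` the exponent is minus a pairing. At `v_{j,s} = ±β` the sign comes out as
  -- `signAt`, leaving the common factor `-(v_{i,p}, β)`.
  have hlow : ∀ n ∈ Finset.range N, (∑ j, if (T - n ≤ ξ j ∧ 2 ∣ ξ j - (T - n)) ∧
        (rootAt hC Q ξ l j (T - n) = β ∨ rootAt hC Q ξ l j (T - n) = -β)
      then c j (T - n - p - 1) - c j (T - n - p + 1) else 0) =
      -latticeForm C (rootAt hC Q ξ l i p) β * ∑ j, signAt hC Q ξ l β (T - n) j := by
    intro n hn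
    rw [Finset.mem_range] at hn
    rw [Finset.mul_sum]
    refine Finset.sum_congr rfl fun j _ => ?_
    rw [signAt]
    by_cases hj : T - (n : ℤ) ≤ ξ j ∧ 2 ∣ ξ j - (T - n)
    · obtain ⟨r, hr⟩ : ∃ r : ℕ, T - (n : ℤ) = p + 1 + r := ⟨N - n - 1, by omega⟩
      have key := form_rootAt_eq hC hQ hξ hl hi hi2 hw hws hc0 hc1 hcs r j
        (by omega) (by rw [← hr]; exact hj.2)
      rw [← hr] at key
      have e1 : T - (n : ℤ) - p - 1 = r := by omega
      have e2 : T - (n : ℤ) - p + 1 = r + 2 := by omega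
      rw [e1, e2, if_pos hj]
      by_cases h1 : rootAt hC Q ξ l j (T - n) = β
      · rw [h1] at key ⊢
        rw [if_pos ⟨hj, Or.inl rfl⟩, if_pos rfl, if_neg hββ, key]
        ring
      · by_cases h2 : rootAt hC Q ξ l j (T - n) = -β
        · rw [h2, map_neg] at key
          rw [h2, if_pos ⟨hj, Or.inr rfl⟩, if_pos rfl, if_neg hββ.symm]
          linarith
        · simp [h1, h2]
    · rw [if_neg hj, if_neg (fun h => hj h.1), mul_zero]
  -- At level `p` the exponent is `c j (-1) - c j 1`, which is `-1` for `j = i` and 0 otherwise.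
  have hlast : (∑ j, if (T - N ≤ ξ j ∧ 2 ∣ ξ j - (T - N)) ∧
        (rootAt hC Q ξ l j (T - N) = β ∨ rootAt hC Q ξ l j (T - N) = -β)
      then c j (T - N - p - 1) - c j (T - N - p + 1) else 0) =
      -if rootAt hC Q ξ l i p = β ∨ rootAt hC Q ξ l i p = -β then 1 else 0 := by
    rw [hN, Finset.sum_eq_single i]
    · rw [hc0 i _ (by omega), show p - p + 1 = 1 by ring, hc1, if_pos rfl]
      by_cases h : rootAt hC Q ξ l i p = β ∨ rootAt hC Q ξ l i p = -β
      · rw [if_pos h, if_pos ⟨⟨hi, hi2⟩, h⟩]; rfl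
      · rw [if_neg h, if_neg (fun h' => h h'.2)]; rfl
    · intro j _ hj
      rw [hc0 j _ (by omega), show p - p + 1 = 1 by ring, hc1, if_neg hj.symm]
      simp
    · simp
  rw [Finset.sum_range_succ, Finset.sum_congr rfl hlow, ← Finset.mul_sum, ← hneg β hβ hpos, hlast]
  have hroot : latticeForm C (rootAt hC Q ξ l i p) (rootAt hC Q ξ l i p) = 2 := by
    rw [← hwi, hw, form_simple, hC.diag]
  by_cases h1 : rootAt hC Q ξ l i p = β
  · have : w.symm β = simple i := by rw [LinearEquiv.symm_apply_eq, hwi, h1]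
    rw [this, negInd, if_neg (not_simple_nonpos i), if_pos (Or.inl h1)]
    simp
  -- Here the indicator is 1, so the upper levels contribute `2` and level `p` contributes `-1`.
  by_cases h2 : rootAt hC Q ξ l i p = -β
  · have : w.symm β = -simple i := by rw [LinearEquiv.symm_apply_eq, map_neg, hwi, h2, neg_neg]
    have hn : -simple i ≤ (0 : V → ℤ) := by
      intro j
      simp only [Pi.neg_apply, simple_apply, Pi.zero_apply]
      split_ifs <;> simp
    rw [this, negInd, if_pos hn, if_pos (Or.inr h2), h2, map_neg, LinearMap.neg_apply, hβ]
    norm_num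
  · have h3 := hC.form_le_one hroot hβ h1
    have h4 := hC.neg_one_le_form hroot hβ h2
    rw [if_neg (by tauto), negInd, abs_le]
    split_ifs <;> constructor <;> linarith

end RootSequence

/-! ### The recursion for the coefficients of the inverse quantum Cartan matrix -/

section QuantumCartan

variable {V : Type*} [Fintype V] {C : Matrix V V ℤ}

theorem coeff_mul_quantumCartan (f : V → LaurentSeries ℤ) (j : V) (m : ℤ) :
    (∑ k, f k * quantumCartan C k j).coeff m =
      (f j).coeff (m - 1) + (f j).coeff (m + 1) -
        ∑ k, if k ≠ j ∧ C k j = -1 then (f k).coeff m else 0 := by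
  have h1 : ∀ g : LaurentSeries ℤ,
      (g * (HahnSeries.single 1 1 + HahnSeries.single (-1) 1)).coeff m =
        g.coeff (m - 1) + g.coeff (m + 1) := by
    intro g
    have e1 := HahnSeries.coeff_mul_single_add (x := g) (r := (1 : ℤ)) (a := m - 1) (b := (1 : ℤ))
    have e2 := HahnSeries.coeff_mul_single_add (x := g) (r := (1 : ℤ)) (a := m + 1) (b := (-1 : ℤ))
    rw [sub_add_cancel, mul_one] at e1
    rw [add_neg_cancel_right, mul_one] at e2
    rw [mul_add, HahnSeries.coeff_add, e1, e2]
  have h2 : ∀ k, f k * quantumCartan C k j =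
      (if k = j then f j * (HahnSeries.single 1 1 + HahnSeries.single (-1) 1) else 0) -
        (if k ≠ j ∧ C k j = -1 then f k else 0) := by
    intro k
    by_cases hk : k = j
    · subst hk; simp [quantumCartan]
    · by_cases h : C k j = -1 <;> simp [quantumCartan, hk, h]
  simp only [h2, Finset.sum_sub_distrib, Finset.sum_ite_eq', Finset.mem_univ, if_true,
    HahnSeries.coeff_sub, h1, HahnSeries.coeff_sum]
  congr 1
  refine Finset.sum_congr rfl fun k _ => ?_
  split_ifs <;> simp

theorem coeff_inv_quantumCartan (C : Matrix V V ℤ) (i j : V) (m : ℤ) :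
    ((quantumCartan C)⁻¹ i j).coeff (m - 1) + ((quantumCartan C)⁻¹ i j).coeff (m + 1) -
      ∑ k, (if k ≠ j ∧ C k j = -1 then ((quantumCartan C)⁻¹ i k).coeff m else 0) =
      if i = j ∧ m = 0 then 1 else 0 := by
  rw [← coeff_mul_quantumCartan (fun k => (quantumCartan C)⁻¹ i k)]
  have h := congrFun (congrFun (Matrix.nonsing_inv_mul _ (isUnit_det_quantumCartan C)) i) j
  rw [Matrix.mul_apply] at h
  rw [h, Matrix.one_apply]
  by_cases hij : i = j
  · by_cases hm : m = 0 <;> simp [hij, hm, HahnSeries.coeff_one]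
  · simp [hij]

/-- The finitely many Laurent series in row `i` have a common lower bound on their orders. From
there the recursion propagates zero upwards, and its inhomogeneous term first affects the
coefficient of `z`. Hence the cut-off in the definition of `cTilde` discards nothing, and `cTilde`
satisfies the recursion without boundary corrections. -/
theorem coeff_inv_quantumCartan_of_nonpos (C : Matrix V V ℤ) (i : V) {m : ℤ} (hm : m ≤ 0) (j : V) :
    ((quantumCartan C)⁻¹ i j).coeff m = 0 := by
  obtain ⟨M, hM⟩ := (Set.finite_range fun j => ((quantumCartan C)⁻¹ i j).order).bddBelow
  have hM' : ∀ j m, m < M → ((quantumCartan C)⁻¹ i j).coeff m = 0 := fun j m h =>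
    HahnSeries.coeff_eq_zero_of_lt_order (lt_of_lt_of_le h (hM ⟨j, rfl⟩))
  have key : ∀ n : ℕ, ∀ j m, m < M + n → m ≤ 0 → ((quantumCartan C)⁻¹ i j).coeff m = 0 := by
    intro n
    induction n with
    | zero => intro j m h _; exact hM' j m (by simpa using h)
    | succ n ih =>
      intro j m h h0
      have e := coeff_inv_quantumCartan C i j (m - 1)
      push_cast at h
      rw [sub_add_cancel, if_neg (by omega), ih j (m - 1 - 1) (by omega) (by omega),
        Finset.sum_eq_zero, zero_add, sub_zero] at e
      · exact e
      · intro k _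
        rw [ih k (m - 1) (by omega) (by omega), ite_self]
  exact key (m + 1 - M).toNat j m (by omega) hm

theorem cTilde_of_nonpos (C : Matrix V V ℤ) (i j : V) {m : ℤ} (hm : m ≤ 0) :
    cTilde C i j m = 0 :=
  if_neg (by omega)

theorem cTilde_eq_coeff (C : Matrix V V ℤ) (i j : V) (m : ℤ) :
    cTilde C i j m = ((quantumCartan C)⁻¹ i j).coeff m := by
  by_cases hm : 1 ≤ m
  · exact if_pos hm
  · rw [cTilde_of_nonpos C i j (by omega), coeff_inv_quantumCartan_of_nonpos C i (by omega)]

theorem cTilde_one (C : Matrix V V ℤ) (i j : V) : cTilde C i j 1 = if i = j then 1 else 0 := by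
  have h := coeff_inv_quantumCartan C i j 0
  rw [coeff_inv_quantumCartan_of_nonpos C i (by omega), Finset.sum_eq_zero, zero_add, sub_zero,
    zero_add, ← cTilde_eq_coeff] at h
  · simpa using h
  · intro k _
    rw [coeff_inv_quantumCartan_of_nonpos C i le_rfl, ite_self]

theorem cTilde_add (hC : IsPosSimplyLaced C) (i j : V) {m : ℤ} (hm : 1 ≤ m) :
    cTilde C i j (m + 1) + cTilde C i j (m - 1) =
      ∑ k, if C k j = -1 then cTilde C i k m else 0 := by
  have h := coeff_inv_quantumCartan C i j m
  rw [if_neg (by omega)] at h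
  simp only [← cTilde_eq_coeff] at h
  have e : ∑ k, (if C k j = -1 then cTilde C i k m else 0) =
      ∑ k, (if k ≠ j ∧ C k j = -1 then cTilde C i k m else 0) := by
    refine Finset.sum_congr rfl fun k _ => ?_
    by_cases hk : k = j
    · subst hk; simp [hC.diag]
    · simp [hk]
  rw [e]
  linarith

end QuantumCartan

/-! ### The order of a prime as a homomorphism on the units of the fraction field -/

section PrimeOrder

variable {A K : Type*} [CommRing A] [IsDomain A] [UniqueFactorizationMonoid A] [Field K]
  [Algebra A K] [IsFractionRing A K]

/-- Cross-multiplying two representations of the same fraction and using additivity of multiplicity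
at a prime shows that any representation computes the order. This frees the additivity proof from
reduced fractions. -/
theorem multiplicity_num_sub_den {p : A} (hp : Prime p) {a d : A} (ha : a ≠ 0) (hd : d ≠ 0) :
    (multiplicity p (IsFractionRing.num A (algebraMap A K a / algebraMap A K d)) : ℤ) -
      (multiplicity p (IsFractionRing.den A (algebraMap A K a / algebraMap A K d) : A) : ℤ) =
      multiplicity p a - multiplicity p d := by
  have hinj := IsFractionRing.injective A K
  have ha' : algebraMap A K a ≠ 0 := by rwa [Ne, map_eq_zero_iff _ hinj]
  have hd' : algebraMap A K d ≠ 0 := by rwa [Ne, map_eq_zero_iff _ hinj]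
  set f := algebraMap A K a / algebraMap A K d with hf
  have hf0 : f ≠ 0 := div_ne_zero ha' hd'
  have hden : (IsFractionRing.den A f : A) ≠ 0 := nonZeroDivisors.coe_ne_zero _
  have hden' : algebraMap A K (IsFractionRing.den A f : A) ≠ 0 := by
    rwa [Ne, map_eq_zero_iff _ hinj]
  have hfe : f = algebraMap A K (IsFractionRing.num A f) /
      algebraMap A K (IsFractionRing.den A f : A) := by
    rw [← IsFractionRing.mk'_eq_div, IsFractionRing.mk'_num_den]
  have heq : a * (IsFractionRing.den A f : A) = IsFractionRing.num A f * d := by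
    apply hinj
    rw [map_mul, map_mul, ← div_eq_div_iff hd' hden', ← hfe]
  have hnum : IsFractionRing.num A f ≠ 0 := by
    intro h
    rw [h, zero_mul] at heq
    exact mul_ne_zero ha hden heq
  have hm := congrArg (multiplicity p) heq
  rw [multiplicity_mul hp (FiniteMultiplicity.of_prime_left hp (mul_ne_zero ha hden)),
    multiplicity_mul hp (FiniteMultiplicity.of_prime_left hp (mul_ne_zero hnum hd))] at hm
  omega

/-- The order of a prime in a rational fraction, as a group morphism. -/
noncomputable def primeOrder {p : A} (hp : Prime p) : Kˣ →* Multiplicative ℤ where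
  toFun f := Multiplicative.ofAdd ((multiplicity p (IsFractionRing.num A (f : K)) : ℤ) -
    (multiplicity p (IsFractionRing.den A (f : K) : A) : ℤ))
  map_one' := by
    have := multiplicity_num_sub_den (K := K) hp (one_ne_zero (α := A)) (one_ne_zero (α := A))
    simp only [map_one, div_one, sub_self] at this
    simp [this]
  map_mul' f g := by
    rw [← ofAdd_add]
    congr 1
    have hrep : ∀ f : Kˣ, ∃ a d : A, a ≠ 0 ∧ d ≠ 0 ∧
        (f : K) = algebraMap A K a / algebraMap A K d := by
      intro f
      obtain ⟨a, d, hd, h⟩ := IsFractionRing.div_surjective (A := A) (f : K)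
      refine ⟨a, d, ?_, nonZeroDivisors.ne_zero hd, h.symm⟩
      rintro rfl
      rw [map_zero, zero_div] at h
      exact f.ne_zero h.symm
    obtain ⟨a, d, ha, hd, hf⟩ := hrep f
    obtain ⟨a', d', ha', hd', hg⟩ := hrep g
    have hfg : ((f * g : Kˣ) : K) = algebraMap A K (a * a') / algebraMap A K (d * d') := by
      rw [Units.val_mul, hf, hg, map_mul, map_mul, div_mul_div_comm]
    rw [hfg, hf, hg, multiplicity_num_sub_den hp ha hd, multiplicity_num_sub_den hp ha' hd',
      multiplicity_num_sub_den hp (mul_ne_zero ha ha') (mul_ne_zero hd hd'),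
      multiplicity_mul hp (FiniteMultiplicity.of_prime_left hp (mul_ne_zero ha ha')),
      multiplicity_mul hp (FiniteMultiplicity.of_prime_left hp (mul_ne_zero hd hd'))]
    push_cast
    ring

theorem toAdd_primeOrder_algebraMap {p : A} (hp : Prime p) {a : A} (ha : a ≠ 0) (f : Kˣ)
    (hf : (f : K) = algebraMap A K a) :
    Multiplicative.toAdd (primeOrder hp f) = (multiplicity p a : ℤ) := by
  have h := multiplicity_num_sub_den (K := K) hp ha (one_ne_zero (α := A))
  rw [map_one, div_one, ← hf, multiplicity_of_one_right hp.not_isUnit] at h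
  simpa [primeOrder] using h

end PrimeOrder

/-! ### Transfer from the root system to the lattice model -/

section Bridge

variable {ι M N : Type*} [AddCommGroup M] [Module ℂ M] [AddCommGroup N] [Module ℂ N]
  {P : RootPairing ι ℂ M N} (b : P.Base)

theorem isPosSimplyLaced_cartanMatrix [Finite ι] [P.IsRootSystem] [P.IsCrystallographic]
    [P.IsReduced] [P.IsIrreducible] (hC : b.cartanMatrix.IsSimplyLaced) :
    IsPosSimplyLaced b.cartanMatrix := by
  have hsymm : ∀ i j, b.cartanMatrix i j = b.cartanMatrix j i := by
    intro i j
    by_cases hij : i = j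
    · rw [hij]
    · have h0 := b.cartanMatrix_apply_eq_zero_iff_symm (i := i) (j := j)
      have h1 := hC hij
      have h2 := hC (Ne.symm hij)
      simp only at h1 h2
      omega
  refine ⟨b.cartanMatrix_apply_same, hsymm, fun i j h => hC h, ?_⟩
  obtain ⟨d, hd, hpos⟩ := b.exists_cartanMatrix_mul_diagaonal_posDef
  intro x hx
  obtain ⟨i₀, -⟩ := Function.ne_iff.1 hx
  -- Symmetry of both `C` and `C * diagonal d` forces `d` to agree on adjacent vertices, and
  -- irreducibility connects all of them. So positivity passes to `C` itself.
  have hconst : ∀ j, d j = d i₀ := by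
    intro j
    refine b.induction_on_cartanMatrix (fun j => d j = d i₀) (i := i₀) rfl ?_
    intro i j hi hji
    have h := hpos.1.apply i j
    simp only [Matrix.mul_diagonal, star_trivial] at h
    rw [hsymm i j] at h
    rw [← hi]
    exact (mul_left_cancel₀ hji h).symm
  have h := hpos.dotProduct_mulVec_pos hx
  have e : star x ⬝ᵥ ((b.cartanMatrix * Matrix.diagonal d).mulVec x) =
      d i₀ * latticeForm b.cartanMatrix x x := by
    simp only [dotProduct, Matrix.mulVec, Matrix.mul_diagonal, latticeForm_apply,
      Finset.mul_sum, hconst, star_trivial]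
    exact Finset.sum_congr rfl fun i _ => Finset.sum_congr rfl fun j _ => by ring
  rw [e] at h
  exact (mul_pos_iff_of_pos_left (hd i₀)).1 h

/-- The embedding of the root lattice. -/
noncomputable def latticeMap : (b.support → ℤ) →ₗ[ℤ] M :=
  Fintype.linearCombination ℤ (fun i : b.support => P.root i)

theorem latticeMap_apply (x : b.support → ℤ) :
    latticeMap b x = ∑ i, x i • P.root i :=
  rfl

theorem latticeMap_simple (i : b.support) : latticeMap b (simple i) = P.root i := by
  simp [latticeMap_apply, simple_apply]

theorem gammaRoot_eq (Q : Digraph b.support) (i : b.support) :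
    gammaRoot b Q i = latticeMap b (gammaVec Q i) := by
  simp [gammaRoot, gammaVec, latticeMap_simple]

section Crystallographic

variable [P.IsCrystallographic]

theorem reflection_latticeMap (hC : IsPosSimplyLaced b.cartanMatrix) (i : b.support)
    (x : b.support → ℤ) :
    P.reflection i (latticeMap b x) = latticeMap b (hC.refl i x) := by
  have h : ∀ k : b.support, P.reflection i (latticeMap b (simple k)) =
      latticeMap b (hC.refl i (simple k)) := by
    intro k
    rw [hC.refl_apply, form_simple, map_sub, map_smul, latticeMap_simple, latticeMap_simple]
    exact P.reflection_apply_root' ℤ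
  rw [eq_sum_simple x]
  simp only [map_sum, map_smul, map_zsmul, h]

theorem coxeterElement_latticeMap (hC : IsPosSimplyLaced b.cartanMatrix) (Q : Digraph b.support)
    (x : b.support → ℤ) :
    coxeterElement b Q (latticeMap b x) = latticeMap b (hC.wordProd (coxeterWord Q) x) := by
  -- In `coxeterElement` the word is coerced to a list of root indices through the list monad; this
  -- rewrites the coercion as an ordinary `List.map`.
  have hmap : ∀ l : List b.support, (do let a ← l; pure (a : ι)) = l.map (↑) :=
    fun l => List.flatMap_pure_eq_map _ l
  rw [coxeterElement, hmap, IsPosSimplyLaced.wordProd]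
  induction coxeterWord Q with
  | nil => simp
  | cons i l ih =>
    simp only [List.map_cons, List.prod_cons, LinearEquiv.mul_apply, ih,
      reflection_latticeMap b hC]

/-- Linearity of `τ` lets the sign chosen at each step be pulled out, whatever the choice is. That
the choice yields a positive root plays no role. -/
theorem betaSeq_eq_or_eq_neg (hC : IsPosSimplyLaced b.cartanMatrix) (Q : Digraph b.support)
    (j : b.support) (m : ℕ) :
    betaSeq b Q j m = latticeMap b ((hC.wordProd (coxeterWord Q) ^ m) (gammaVec Q j)) ∨
    betaSeq b Q j m = -latticeMap b ((hC.wordProd (coxeterWord Q) ^ m) (gammaVec Q j)) := by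
  induction m with
  | zero => left; simp [betaSeq, gammaRoot_eq]
  | succ m ih =>
    have h : coxeterElement b Q (betaSeq b Q j m) =
        latticeMap b ((hC.wordProd (coxeterWord Q) ^ (m + 1)) (gammaVec Q j)) ∨
        coxeterElement b Q (betaSeq b Q j m) =
        -latticeMap b ((hC.wordProd (coxeterWord Q) ^ (m + 1)) (gammaVec Q j)) := by
      rw [pow_succ', LinearEquiv.mul_apply, ← coxeterElement_latticeMap]
      rcases ih with h | h <;> rw [h]
      · exact Or.inl rfl
      · exact Or.inr (map_neg _ _)
    rw [betaSeq]
    split_ifs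
    · exact h
    · rcases h with h | h <;> rw [h]
      · exact Or.inr rfl
      · exact Or.inl (neg_neg _)

/-- A positive root is a non-negative lattice vector of square length `2`. -/
theorem exists_latticeMap_eq_root [Finite ι] [P.IsRootSystem] [P.IsReduced]
    (hC : IsPosSimplyLaced b.cartanMatrix) {k : ι}
    (hk : b.IsPos k) :
    ∃ y : b.support → ℤ, latticeForm b.cartanMatrix y y = 2 ∧ 0 ≤ y ∧
      latticeMap b y = P.root k := by
  obtain ⟨y, hy, hyk⟩ : ∃ y : b.support → ℤ, latticeForm b.cartanMatrix y y = 2 ∧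
      latticeMap b y = P.root k := by
    refine hk.induction_on_reflect (p := fun k => ∃ y : b.support → ℤ,
      latticeForm b.cartanMatrix y y = 2 ∧ latticeMap b y = P.root k) ?_ ?_
    · intro i hi
      exact ⟨simple ⟨i, hi⟩, by rw [form_simple, hC.diag], latticeMap_simple b ⟨i, hi⟩⟩
    · rintro i j ⟨y, hy, hyi⟩ hj
      refine ⟨hC.refl ⟨j, hj⟩ y, by rw [hC.form_refl, hy], ?_⟩
      rw [← reflection_latticeMap, hyi, P.root_reflectionPerm]
  refine ⟨y, hy, ?_, hyk⟩
  rcases hC.nonneg_or_nonpos hy with h | h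
  · exact h
  -- A nonpositive coordinate vector would give a nonpositive height, against positivity of the
  -- root.
  · exfalso
    have hh := b.height_eq_sum (i := k) (f := fun j => if hj : j ∈ b.support then y ⟨j, hj⟩ else 0)
      (by
        rw [← hyk, latticeMap_apply, ← Finset.sum_coe_sort b.support]
        simp)
    have hk' : 0 < b.height k := hk
    rw [hh, ← Finset.sum_coe_sort b.support] at hk'
    simp only [Finset.coe_mem, dif_pos, Subtype.coe_eta] at hk'
    have := Finset.sum_nonpos (s := Finset.univ) fun (j : b.support) _ => h j
    omega

end Crystallographic

variable [P.IsRootSystem]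

theorem repr_latticeMap (x : b.support → ℤ) (i : b.support) :
    b.toWeightBasis.repr (latticeMap b x) i = (x i : ℂ) := by
  simp [latticeMap_apply, Finsupp.single_apply]

theorem coeff_linForm (v : M) (i : b.support) :
    (linForm b v).coeff (Finsupp.single i 1) = b.toWeightBasis.repr v i := by
  simp [linForm, MvPolynomial.coeff_sum, MvPolynomial.coeff_C_mul, MvPolynomial.coeff_X,
    Finsupp.single_left_inj]

theorem linForm_neg (v : M) : linForm b (-v) = -linForm b v := by
  simp [linForm]

/-- A polynomial of total degree 1 over a field is irreducible: any constant dividing it divides a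
nonzero coefficient and is a unit. -/
theorem prime_linForm {v : M} (hv : v ≠ 0) : Prime (linForm b v) := by
  refine Irreducible.prime ?_
  obtain ⟨i, hi⟩ : ∃ i, b.toWeightBasis.repr v i ≠ 0 := by
    by_contra h
    push Not at h
    exact hv (b.toWeightBasis.repr.map_eq_zero_iff.1 (Finsupp.ext h))
  refine MvPolynomial.irreducible_of_totalDegree_eq_one (le_antisymm ?_ ?_) ?_
  · refine MvPolynomial.totalDegree_finsetSum_le fun j _ => ?_
    refine (MvPolynomial.totalDegree_mul _ _).trans ?_
    simp
  · rw [← not_lt, Nat.lt_one_iff, MvPolynomial.totalDegree_eq_zero_iff]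
    intro h
    have := h (Finsupp.single i 1) (by rwa [MvPolynomial.mem_support_iff, coeff_linForm]) i
    simp at this
  · intro r hr
    have h := hr (Finsupp.single i 1)
    rw [coeff_linForm] at h
    exact isUnit_of_dvd_unit h (Ne.isUnit hi)

/-- If one linear form divides the other, both being prime, they differ by a constant. Their integer
coordinate vectors are then proportional, and having the same norm they agree up to sign. -/
theorem multiplicity_linForm [P.IsCrystallographic]
    {x y : b.support → ℤ} (hx : latticeForm b.cartanMatrix x x = 2)
    (hy : latticeForm b.cartanMatrix y y = 2) :
    multiplicity (linForm b (latticeMap b y)) (linForm b (latticeMap b x)) =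
      if x = y ∨ x = -y then 1 else 0 := by
  have hne : ∀ z : b.support → ℤ, latticeForm b.cartanMatrix z z = 2 →
      ∃ i, z i ≠ 0 ∧ latticeMap b z ≠ 0 := by
    intro z hz
    obtain ⟨i, hi⟩ : ∃ i, z i ≠ 0 := by
      by_contra h
      push Not at h
      rw [show z = 0 from funext h] at hz
      simp at hz
    refine ⟨i, hi, fun h => hi ?_⟩
    have := repr_latticeMap b z i
    rw [h] at this
    simpa using this.symm
  obtain ⟨-, -, hx0⟩ := hne x hx
  obtain ⟨i, hi, hy0⟩ := hne y hy
  split_ifs with h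
  · have ha : Associated (linForm b (latticeMap b x)) (linForm b (latticeMap b y)) := by
      rcases h with rfl | rfl
      · exact Associated.refl _
      · rw [map_neg, linForm_neg]
        exact (Associated.refl _).neg_left
    rw [multiplicity_eq_of_associated_right ha, multiplicity_self]
  · rw [multiplicity_eq_zero]
    intro hdvd
    apply h
    obtain ⟨u, hu⟩ := (prime_linForm b hy0).associated_of_dvd (prime_linForm b hx0) hdvd
    obtain ⟨r, -, hr⟩ := MvPolynomial.isUnit_iff_eq_C_of_isReduced.1 u.isUnit
    have hcoef : ∀ j, (y j : ℂ) * r = x j := by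
      intro j
      have := congrArg (MvPolynomial.coeff (Finsupp.single j 1)) hu
      rwa [hr, mul_comm, MvPolynomial.coeff_C_mul, mul_comm, coeff_linForm, coeff_linForm, repr_latticeMap,
        repr_latticeMap] at this
    -- Eliminating the complex scalar `r` brings the proportionality back to the integral lattice,
    -- where norms can be compared.
    have hprop : y i • x = x i • y := by
      ext j
      have : (y i : ℂ) * x j = x i * y j := by rw [← hcoef j, ← hcoef i]; ring
      exact_mod_cast this
    have hform := congrArg (fun z => latticeForm b.cartanMatrix z z) hprop
    simp only [map_smul, LinearMap.smul_apply, hx, hy, smul_eq_mul] at hform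
    have hsq : x i * x i = y i * y i := by linarith
    rcases mul_self_eq_mul_self_iff.1 hsq with h1 | h1
    · left
      rw [h1] at hprop
      exact smul_right_injective _ hi hprop
    · right
      rw [h1, neg_smul, ← smul_neg] at hprop
      exact smul_right_injective _ hi hprop

/-- All heights lie below `T` and `G` vanishes below `p`, so the sum lives on the levels `s = T - n`
with `n ≤ N`. The bound and parity conditions select the places of `I^{≤ξ}` on each level. -/
theorem finsum_below {V : Type*} [Fintype V] {ξ : V → ℤ} (G : V → ℤ → ℤ) {p T : ℤ} {N : ℕ}
    (hN : T - N = p) (hT : ∀ k, ξ k < T) (hG : ∀ j s, s < p → G j s = 0) :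
    ∑ᶠ y : Below ξ, G y.1.1 y.1.2 =
      ∑ n ∈ Finset.range (N + 1), ∑ j,
        if T - n ≤ ξ j ∧ 2 ∣ ξ j - (T - n) then G j (T - n) else 0 := by
  let S : Set (V × ℤ) := {x | ∃ k : ℕ, x.2 = ξ x.1 - 2 * (k : ℤ)}
  have hS : ∀ j s, (j, s) ∈ S ↔ s ≤ ξ j ∧ 2 ∣ ξ j - s := by
    intro j s
    constructor
    · rintro ⟨k, hk⟩
      simp only at hk
      omega
    · rintro ⟨h1, h2⟩
      exact ⟨((ξ j - s) / 2).toNat, by simp only; omega⟩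
  have h1 : ∑ᶠ y : Below ξ, G y.1.1 y.1.2 = ∑ᶠ z ∈ S, G z.1 z.2 :=
    finsum_set_coe_eq_finsum_mem (f := fun z : V × ℤ => G z.1 z.2) S
  let F : ℕ × V → V × ℤ := fun z => (z.2, T - z.1)
  have hF : Function.Injective F := by
    rintro ⟨n, j⟩ ⟨n', j'⟩ h
    simp only [F, Prod.mk.injEq] at h
    ext <;> simp <;> grind
  rw [h1, finsum_mem_def, finsum_eq_sum_of_support_subset
    (s := (Finset.range (N + 1) ×ˢ Finset.univ).image F), Finset.sum_image hF.injOn,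
    Finset.sum_product]
  · refine Finset.sum_congr rfl fun n _ => Finset.sum_congr rfl fun j _ => ?_
    simp only [F, Set.indicator_apply, hS]
  · rintro ⟨j, s⟩ hs
    rw [Function.mem_support, Set.indicator_apply_ne_zero] at hs
    obtain ⟨h2, h3⟩ := hs
    rw [hS] at h2
    have h4 : p ≤ s := by
      by_contra h
      exact h3 (hG j s (not_le.1 h))
    have := hT j
    rw [Finset.mem_coe, Finset.mem_image]
    refine ⟨((T - s).toNat, j), ?_, ?_⟩
    · simp
      omega
    · simp only [F, Prod.mk.injEq, true_and]
      omega

theorem abs_rootMult_dTilde_le [Finite ι] [P.IsCrystallographic] [P.IsReduced] [P.IsIrreducible]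
    (hSL : b.cartanMatrix.IsSimplyLaced) (Q : Digraph b.support) (hQ : IsOrientation b Q)
    (ξ : b.support → ℤ) (hξ : IsHeightFunction Q ξ) (x : Below ξ) {k : ι} (hk : b.IsPos k) :
    |rootMult b (P.root k) (dTilde b Q ξ (yVar x))| ≤ 1 := by
  have hC := isPosSimplyLaced_cartanMatrix b hSL
  have hQ' : IsOrientationOf Q b.cartanMatrix := ⟨hQ.1, hQ.2⟩
  have hl := coxeterWord_spec Q ξ hξ
  obtain ⟨y, hy, hpos, hyk⟩ := exists_latticeMap_eq_root b hC hk
  have hroot0 : P.root k ≠ 0 := P.ne_zero k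
  have hp := prime_linForm b hroot0
  obtain ⟨⟨i, p⟩, m, hm⟩ := x
  simp only at hm
  obtain ⟨T₀, hT₀⟩ := (Set.finite_range ξ).bddAbove
  let T := T₀ + 1
  have hT : ∀ j, ξ j < T := fun j => Int.lt_add_one_of_le (hT₀ ⟨j, rfl⟩)
  obtain ⟨N, hN⟩ : ∃ N : ℕ, T - N = p := ⟨(T - p).toNat, by have := hT i; omega⟩
  have hmain := abs_sum_exponent_le hC hQ' hξ hl (i := i) (p := p) (by omega) (by omega) hT hN
    (c := cTilde b.cartanMatrix i) (fun j m => cTilde_of_nonpos _ i j) (cTilde_one _ i)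
    (fun j m hm => cTilde_add hC i j hm) hy hpos
  have hval : rootMult b (P.root k) (dTilde b Q ξ (yVar ⟨(i, p), m, hm⟩)) =
      Multiplicative.toAdd (primeOrder hp (dTildeValue b Q ξ ⟨(i, p), m, hm⟩)) := by
    rw [dTilde_yVar]
    rfl
  have hbeta : ∀ z : Below ξ, Multiplicative.toAdd (primeOrder hp (betaUnit b Q z)) =
      if rootAt hC Q ξ (coxeterWord Q) z.1.1 z.1.2 = y ∨
        rootAt hC Q ξ (coxeterWord Q) z.1.1 z.1.2 = -y then 1 else 0 := by
    intro z
    -- Truncating at level `s` exhibits `v_{j,s}` as the image of `α_j` under an isometry.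
    have hnorm : latticeForm b.cartanMatrix (rootAt hC Q ξ (coxeterWord Q) z.1.1 z.1.2)
        (rootAt hC Q ξ (coxeterWord Q) z.1.1 z.1.2) = 2 := by
      obtain ⟨⟨j, s⟩, r, hr⟩ := z
      simp only at hr
      obtain ⟨n, hn⟩ : ∃ n : ℕ, T - n = s := ⟨(T - s).toNat, by have := hT j; omega⟩
      obtain ⟨w, hw, hws, -⟩ := exists_truncated hC hQ' hξ hl hT n
      have h := hws j
      rw [hn, truncatedVec, if_neg (by omega), if_pos (by omega)] at h
      rw [← h, hw, form_simple, hC.diag]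
    rw [toAdd_primeOrder_algebraMap hp (linForm_ne_zero b (beta_ne_zero b Q z)) _ rfl]
    -- The sign ambiguity of `β_{j,s}` only changes the linear form by a unit.
    have hb : linForm b (beta b Q z) =
        linForm b (latticeMap b (rootAt hC Q ξ (coxeterWord Q) z.1.1 z.1.2)) ∨
        linForm b (beta b Q z) =
        -linForm b (latticeMap b (rootAt hC Q ξ (coxeterWord Q) z.1.1 z.1.2)) := by
      rcases betaSeq_eq_or_eq_neg b hC Q z.1.1 ((ξ z.1.1 - z.1.2) / 2).toNat with h | h
      · left; rw [beta, h]; rfl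
      · right; rw [beta, h, linForm_neg]; rfl
    have ha : Associated (linForm b (beta b Q z))
        (linForm b (latticeMap b (rootAt hC Q ξ (coxeterWord Q) z.1.1 z.1.2))) := by
      rcases hb with h | h <;> rw [h]
      exact (Associated.refl _).neg_left
    rw [multiplicity_eq_of_associated_right ha, ← hyk, multiplicity_linForm b hnorm hy]
    push_cast
    rfl
  let G : b.support → ℤ → ℤ := fun j s =>
    (cTilde b.cartanMatrix i j (s - p - 1) - cTilde b.cartanMatrix i j (s - p + 1)) *
      if rootAt hC Q ξ (coxeterWord Q) j s = y ∨ rootAt hC Q ξ (coxeterWord Q) j s = -y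
      then 1 else 0
  have hsum : Multiplicative.toAdd (primeOrder hp (dTildeValue b Q ξ ⟨(i, p), m, hm⟩)) =
      ∑ᶠ z : Below ξ, G z.1.1 z.1.2 := by
    have hG : ∀ z : Below ξ, Multiplicative.toAdd (primeOrder hp (betaUnit b Q z ^
        (cTilde b.cartanMatrix i z.1.1 (z.1.2 - p - 1) -
          cTilde b.cartanMatrix i z.1.1 (z.1.2 - p + 1)))) = G z.1.1 z.1.2 := by
      intro z
      rw [map_zpow, toAdd_zpow, hbeta z, smul_eq_mul]
    have hfin := finite_mulSupport_dTildeValue b Q ξ ⟨(i, p), m, hm⟩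
    rw [dTildeValue, finprod_eq_prod_of_mulSupport_subset _ hfin.coe_toFinset.ge, map_prod,
      toAdd_prod, finsum_eq_sum_of_support_subset (s := hfin.toFinset)]
    · exact Finset.sum_congr rfl fun z _ => hG z
    · intro z hz
      rw [Set.Finite.coe_toFinset]
      intro h
      simp only at h
      rw [Function.mem_support, ← hG z, h, map_one, toAdd_one] at hz
      exact hz rfl
  rw [hval, hsum, finsum_below G hN hT]
  · convert hmain using 1
    congr 1
    refine Finset.sum_congr rfl fun n _ => Finset.sum_congr rfl fun j _ => ?_
    simp only [G, mul_ite, mul_one, mul_zero, ite_and]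
  · intro j s hs
    simp only [G]
    rw [cTilde_of_nonpos _ _ _ (by omega), cTilde_of_nonpos _ _ _ (by omega), sub_zero, zero_mul]

end Bridge

end DynkinQuiver

theorem proposition6p9 {L : Type*} [LieRing L] [LieAlgebra ℂ L] [FiniteDimensional ℂ L]
    [LieAlgebra.IsSimple ℂ L] (H : LieSubalgebra ℂ L) [H.IsCartanSubalgebra]
    (b : (LieAlgebra.IsKilling.rootSystem H).Base) (hC : b.cartanMatrix.IsSimplyLaced)
    (Q : Digraph b.support) (hQ : DynkinQuiver.IsOrientation b Q)
    (ξ : b.support → ℤ) (hξ : DynkinQuiver.IsHeightFunction Q ξ)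
    (x : DynkinQuiver.Below ξ) (β : H.root) (hβ : b.IsPos β) :
    |DynkinQuiver.rootMult b ((LieAlgebra.IsKilling.rootSystem H).root β)
      (DynkinQuiver.dTilde b Q ξ (DynkinQuiver.yVar x))| ≤ 1 :=
  DynkinQuiver.abs_rootMult_dTilde_le b hC Q hQ ξ hξ x hβ
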